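/- **Setting.** Let $Q\in\mathbb R^{m\times d}$ (rows $q_i$), $K,V\in\mathbb R^{n\times d}$ (rows $k_l,v_l$) and $\beta>0$. Softmax attention is $O=\Big(\frac{\sum_l e^{\beta\langle q_i,k_l\rangle}v_l}{\sum_l e^{\beta\langle q_i,k_l\rangle}}\Big)_{i\in[m]}$. Write $\|M\|_{\max}=\max_{i,j}|M_{ij}|$, let $\bar k=\frac1n\sum_l k_l$, and put $R_Q=\max_i\|q_i\|_2$, $R_K=\max_l\|k_l-\bar k\|_2$ (the radius of the recentred keys). $W_0$ is the principal branch of the Lambert function and $\rho_0=\sqrt{1+e^{W_0(2/e^2)+2}}$. **Algorithm (WildCat, rank parameter $r$, one bin).** Replace the keys by $k_l-\bar k$; set $b_0=\frac{\log n}{\beta R_QR_K}+2$, $\tau^2=\frac{R_K}{R_Q}\cdot\frac{b_0}{2W_0(b_0/(2\rho_0))}$ and $h_\tau(x,y)=e^{\beta\langle x,y\rangle/\tau^2}$ (with $h_\tau\equiv1$ if $R_QR_K=0$). Choose a coreset $S$ of pivots by at most $r$ rounds of randomly pivoted Cholesky: start with $p_l=h_\tau(k_l,k_l)$; in each round draw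 a pivot $s$ with probability $p_s/\sum_l p_l$ (do nothing if all $p_l=0$), add it to $S$, update $h_\tau(K_S,K_S)^{-1}$ by a rank-one correction, and replace $p$ by the diagonal of $h_\tau(K,K)-h_\tau(K,K_S)h_\tau(K_S,K_S)^{-1}h_\tau(K_S,K)$. With $W=h_\tau(K_S,K_S)^{-1}h_\tau(K_S,K)$, $V_S=WV$, $w=W\mathbf 1$, return to the original (uncentred) coreset keys, let $\widehat A=(e^{\beta\langle q_i,k_s\rangle})_{i\in[m],s\in S}$, and output $\widehat O_r$, whose $i$-th row is $(\widehat AV_S)_i/(\widehat Aw)_i$ if $(\widehat Aw)_i>0$ and $0$ otherwise, each column $j$ being clipped to $[\min_l V_{lj},\max_l V_{lj}]$. Its running time is the number of elementary operations: real arithmetic, comparisons, stores, evaluations of $\exp$, $\log$, $\sqrt{\cdot}$, $W_0$ count one each, and sampling from $n$ weights counts $2n+1$. **Corollary (super-polynomial error decay in near-linear time).** Let $\alpha\in(0,1)$, let $g(n)=O((\log n)^\alpha)$ and let $d=d(n)\in\mathbb N$ with $d(n)=o(\log n)$. 1. For every real sequence $a(n)=o(\log\log n)$ there are ranks $r(n)\in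 n^{o(1)}$, depending only on $\alpha,g,d,a$, such that for all $n\ge1$, all $m$, and all inputs $\beta>0$, $Q\in\mathbb R^{m\times d(n)}$, $K,V\in\mathbb R^{n\times d(n)}$ with $\beta R_QR_K\le g(n)$, $$\mathbb E\,\|O-\widehat O_{r(n)}\|_{\max}\le 3\,\|V\|_{\max}\,n^{-a(n)},$$ and with these ranks WildCat uses, on every input and for every outcome of the random choices, at most $(m+n)\,n^{o(1)}$ operations, with an $o(1)$ that depends on $n$ only (hence near-linear time $n^{1+o(1)}$ if $m=O(n)$). 2. In particular, the error can be made to decay super-polynomially in near-linear time: there are ranks $r(n)\in n^{o(1)}$ for which WildCat uses at most $(m+n)\,n^{o(1)}$ operations as in 1, and such that for every $t\in\mathbb R$ and all sufficiently large $n$, every input with $\beta R_QR_K\le g(n)$ satisfies $\mathbb E\,\|O-\widehat O_{r(n)}\|_{\max}\le\|V\|_{\max}\,n^{-t}$. -/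

import Mathlib

open Filter Asymptotics
open scoped ENNReal

noncomputable section

namespace WildCat

/-! ## Norms, Lambert `W`, growth rates -/

/-- The entrywise maximum norm (`0` for an empty matrix). -/
def maxNorm {m n : ℕ} (A : Matrix (Fin m) (Fin n) ℝ) : ℝ := ⨆ i, ⨆ j, |A i j|

/-- The maximum of the Euclidean norms of the rows (`0` for an empty matrix). -/
def rowNorm {m n : ℕ} (A : Matrix (Fin m) (Fin n) ℝ) : ℝ := ⨆ i, Real.sqrt (∑ j, A i j ^ 2)

open Classical in
/-- The principal branch of the Lambert function: the unique `w > -1` with `w * exp w = z`,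
which exists exactly for `z > -1 / e` (and is used only for `z > 0`). -/
def lambertW (z : ℝ) : ℝ :=
  if h : ∃ w : ℝ, -1 < w ∧ w * Real.exp w = z then h.choose else 0

/-- The constant `ρ₀ = √(1 + exp (W₀(2 / e²) + 2)) ≈ 3.19`. -/
def rhoZero : ℝ := Real.sqrt (1 + Real.exp (lambertW (2 / Real.exp 1 ^ 2) + 2))

/-- `f ∈ n^{o(1)}`. -/
def IsSubpolynomial (f : ℕ → ℝ) : Prop :=
  ∃ e : ℕ → ℝ, e =o[atTop] (fun _ => (1 : ℝ)) ∧ ∀ᶠ n : ℕ in atTop, f n = (n : ℝ) ^ e n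

/-! ## Attention -/

/-- The keys after subtracting their mean from every row. -/
def recentred {n d : ℕ} (K : Matrix (Fin n) (Fin d) ℝ) : Matrix (Fin n) (Fin d) ℝ :=
  fun l j => K l j - (∑ l', K l' j) / n

/-- Exact softmax attention. -/
def attention {m n d : ℕ} (β : ℝ) (Q : Matrix (Fin m) (Fin d) ℝ) (K V : Matrix (Fin n) (Fin d) ℝ) :
    Matrix (Fin m) (Fin d) ℝ :=
  fun i j => (∑ l, Real.exp (β * ∑ c, Q i c * K l c) * V l j) /
    ∑ l, Real.exp (β * ∑ c, Q i c * K l c)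

/-! ## Real-number computations with an operation count -/

/-- The result of a computation with real numbers, together with the number of elementary
operations it took. -/
structure Timed (α : Type) where
  val : α
  cost : ℕ

namespace Timed

variable {α : Type} {k : ℕ}

/-- Sequential composition adds the operation counts. -/
instance : Monad Timed where
  pure a := ⟨a, 0⟩
  bind x f := ⟨(f x.val).val, x.cost + (f x.val).cost⟩

/- The elementary operations; each one costs one unit. -/
def add (x y : ℝ) : Timed ℝ := ⟨x + y, 1⟩
def sub (x y : ℝ) : Timed ℝ := ⟨x - y, 1⟩
def mul (x y : ℝ) : Timed ℝ := ⟨x * y, 1⟩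
def div (x y : ℝ) : Timed ℝ := ⟨x / y, 1⟩
def sqrt (x : ℝ) : Timed ℝ := ⟨Real.sqrt x, 1⟩
def exp (x : ℝ) : Timed ℝ := ⟨Real.exp x, 1⟩
def log (x : ℝ) : Timed ℝ := ⟨Real.log x, 1⟩
def lambert (x : ℝ) : Timed ℝ := ⟨lambertW x, 1⟩
def min (x y : ℝ) : Timed ℝ := ⟨Min.min x y, 1⟩
def max (x y : ℝ) : Timed ℝ := ⟨Max.max x y, 1⟩
open Classical in
def isPos (x : ℝ) : Timed Bool := ⟨decide (0 < x), 1⟩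

/-- Compute and store the entries of an array one after the other
(one unit per entry for the store). -/
def vec (f : Fin k → Timed α) : Timed (Fin k → α) := ⟨fun i => (f i).val, ∑ i, ((f i).cost + 1)⟩

/-- A loop that sums up (one unit per summand for the addition). -/
def sum (f : Fin k → Timed ℝ) : Timed ℝ := ⟨∑ i, (f i).val, ∑ i, ((f i).cost + 1)⟩

/-- A loop that takes the maximum (one unit per entry for the comparison). -/
def maxOver (f : Fin k → Timed ℝ) : Timed ℝ := ⟨⨆ i, (f i).val, ∑ i, ((f i).cost + 1)⟩

/-- A loop that takes the minimum (one unit per entry for the comparison). -/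
def minOver (f : Fin k → Timed ℝ) : Timed ℝ := ⟨⨅ i, (f i).val, ∑ i, ((f i).cost + 1)⟩

/-- The Euclidean inner product. -/
def dot (x y : Fin k → ℝ) : Timed ℝ := sum fun i => mul (x i) (y i)

end Timed

/-- A randomized computation: the joint law of its result and of its operation count. -/
def Rand (α : Type) : Type := PMF (Timed α)

namespace Rand

instance : Monad Rand where
  pure a := PMF.pure (⟨a, 0⟩ : Timed _)
  bind p f := PMF.bind p fun x => PMF.map (fun y => ⟨y.val, x.cost + y.cost⟩) (f x.val)

instance : MonadLift Timed Rand where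
  monadLift t := PMF.pure t

open Classical in
/-- Draw an index with probability proportional to the weights `p l ≥ 0`; the result is `none` if
all weights vanish. The charge covers the `n` additions for the total weight, one uniform random
number, and `n` comparisons with the partial sums. -/
def sample {n : ℕ} (p : Fin n → ℝ) : Rand (Option (Fin n)) :=
  if h : ∑' l, ENNReal.ofReal (p l) ≠ 0 then
    PMF.map (fun l => ⟨some l, 2 * n + 1⟩)
      (PMF.normalize (fun l => ENNReal.ofReal (p l)) h
        (by rw [tsum_fintype]; exact ENNReal.sum_ne_top.2 fun _ _ => ENNReal.ofReal_ne_top))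
  else PMF.pure ⟨none, 2 * n + 1⟩

/-- The support: the outcomes, with their operation counts, that have positive probability. -/
def outcomes {α : Type} (p : Rand α) : Set (Timed α) := PMF.support p

/-- The expectation of a nonnegative real function of the result. -/
def expect {α : Type} (p : Rand α) (f : α → ℝ) : ℝ≥0∞ :=
  ∑' x : Timed α, (show PMF (Timed α) from p) x * ENNReal.ofReal (f x.val)

end Rand

open Timed

/-! ## The algorithm -/

/-- The scaled exponential kernel `exp (β ⟨x, y⟩ / τ²)`. For `τ = 0` this is the constant kernel `1`
(since `x / 0 = 0`), the limit `τ → ∞`. -/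
def kernel {d : ℕ} (β τ : ℝ) (x y : Fin d → ℝ) : Timed ℝ := do
  let u ← mul β (← dot x y)
  let t ← mul τ τ
  exp (← div u t)

/-- The state of randomly pivoted Nyström: the pivots chosen so far (`none` for an empty slot),
the inverse `M` of the coreset kernel matrix, the rows `R = h(K_S, K)`, and the residual diagonal
`p`. Unused rows and columns of `M` and `R` are zero. -/
structure NysState (n r : ℕ) where
  S : Fin r → Option (Fin n)
  M : Fin r → Fin r → ℝ
  R : Fin r → Fin n → ℝ
  p : Fin n → ℝ

/-- Add the pivot `s` in slot `i`. -/
def nysUpdate {n d r : ℕ} (K : Matrix (Fin n) (Fin d) ℝ)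
    (h : (Fin d → ℝ) → (Fin d → ℝ) → Timed ℝ) (i : Fin r) (s : Fin n) (st : NysState n r) :
    Timed (NysState n r) := do
  let g₀ ← vec fun j => sum fun k => mul (st.M j k) (st.R k s)
  let c ← sqrt (st.p s)
  let g ← vec fun j => if j = i then div (-1) c else div (g₀ j) c
  let M ← vec fun j => vec fun k => do add (st.M j k) (← mul (g j) (g k))
  let row ← vec fun l => h (K s) (K l)
  let R := Function.update st.R i row
  let δ ← vec fun l => sum fun j => mul (g j) (R j l)
  let p ← vec fun l => do sub (st.p l) (← mul (δ l) (δ l))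
  return ⟨Function.update st.S i (some s), M, R, Function.update p s 0⟩

/-- One round: sample a pivot from the residual diagonal and add it. Nothing happens if the residual
diagonal vanishes, that is, if the kernel matrix is already reproduced exactly. -/
def nysStep {n d r : ℕ} (K : Matrix (Fin n) (Fin d) ℝ)
    (h : (Fin d → ℝ) → (Fin d → ℝ) → Timed ℝ) (st : NysState n r) (i : Fin r) :
    Rand (NysState n r) := do
  match ← Rand.sample st.p with
  | none => return st
  | some s => nysUpdate K h i s st

/-- RPNys (randomly pivoted Nyström) with `r` rounds: returns the coreset and the Nyström weights
`W = h(K_S, K_S)⁻¹ h(K_S, K)`. Slots that stay empty have zero weight. -/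
def rpNys {n d : ℕ} (K : Matrix (Fin n) (Fin d) ℝ) (h : (Fin d → ℝ) → (Fin d → ℝ) → Timed ℝ)
    (r : ℕ) : Rand (Matrix (Fin r) (Fin d) ℝ × Matrix (Fin r) (Fin n) ℝ) := do
  let p ← vec fun l => h (K l) (K l)
  let M ← vec fun _ : Fin r => vec fun _ : Fin r => (pure 0 : Timed ℝ)
  let R ← vec fun _ : Fin r => vec fun _ : Fin n => (pure 0 : Timed ℝ)
  let st ← (List.finRange r).foldlM (nysStep K h) (⟨fun _ => none, M, R, p⟩ : NysState n r)
  let KS ← vec fun i => vec fun j => (pure (match st.S i with | none => 0 | some s => K s j) : Timed ℝ)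
  let W ← vec fun i => vec fun l => sum fun k => mul (st.M i k) (st.R k l)
  return (KS, W)

/-- The temperature `τ = √((R_K / R_Q) · b₀ / (2 W₀(b₀ / (2 ρ₀))))` with
`b₀ = log n / (β R_Q R_K) + 2`. If `R_Q = 0` or `R_K = 0`, this gives `τ = 0`, and `kernel` is the
constant `1`. -/
def getTemperature (β RQ RK : ℝ) (n : ℕ) : Timed ℝ := do
  let x ← mul (← mul β RQ) RK
  let b ← add (← div (← log n) x) 2
  let w ← lambert (← div b (← mul 2 rhoZero))
  let t ← div b (← mul 2 w)
  sqrt (← mul (← div RK RQ) t)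

/-- `rowNorm`, computed. -/
def radius {n d : ℕ} (A : Matrix (Fin n) (Fin d) ℝ) : Timed ℝ :=
  maxOver fun l => do sqrt (← dot (A l) (A l))

/-- CompressKV with a single bin: returns the coreset keys, the compressed values `W V` and the
normalization weights `W 1`. -/
def compressKV {n d : ℕ} (K V : Matrix (Fin n) (Fin d) ℝ) (RQ β : ℝ) (r : ℕ) :
    Rand (Matrix (Fin r) (Fin d) ℝ × Matrix (Fin r) (Fin d) ℝ × (Fin r → ℝ)) := do
  let kbar ← vec fun j => do div (← sum fun l => (pure (K l j) : Timed ℝ)) n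
  let Kc ← vec fun l => vec fun j => sub (K l j) (kbar j)
  let RK ← radius Kc
  let τ ← getTemperature β RQ RK n
  let (KS₀, W) ← rpNys Kc (kernel β τ) r
  let KS ← vec fun i => vec fun j => add (KS₀ i j) (kbar j)
  let VS ← vec fun i => vec fun j => sum fun l => mul (W i l) (V l j)
  let w ← vec fun i => sum fun l => (pure (W i l) : Timed ℝ)
  return (KS, VS, w)

/-- WtdAttn: weighted attention over the coreset, clipped to the range of the values. -/
def wtdAttn {m d r : ℕ} (Q : Matrix (Fin m) (Fin d) ℝ) (KS VS : Matrix (Fin r) (Fin d) ℝ)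
    (w : Fin r → ℝ) (vmin vmax : Fin d → ℝ) (β : ℝ) : Timed (Matrix (Fin m) (Fin d) ℝ) := do
  let A ← vec fun i => vec fun s => do exp (← mul β (← dot (Q i) (KS s)))
  let D ← vec fun i => sum fun s => mul (A i s) (w s)
  vec fun i => vec fun j => do
    let num ← sum fun s => mul (A i s) (VS s j)
    let o ← if (← isPos (D i)) then div num (D i) else (pure 0 : Timed ℝ)
    max (vmin j) (← min o (vmax j))

/-- WildCat with rank parameter `r` and a single bin. -/
def wildcat {m n d : ℕ} (Q : Matrix (Fin m) (Fin d) ℝ) (K V : Matrix (Fin n) (Fin d) ℝ) (β : ℝ)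
    (r : ℕ) : Rand (Matrix (Fin m) (Fin d) ℝ) := do
  let vmin ← vec fun j => minOver fun l => (pure (V l j) : Timed ℝ)
  let vmax ← vec fun j => maxOver fun l => (pure (V l j) : Timed ℝ)
  let RQ ← radius Q
  let (KS, VS, w) ← compressKV K V RQ β r
  wtdAttn Q KS VS w vmin vmax β

/-- `E ‖O - Ô_r‖_max`. -/
def expectedError {m n d : ℕ} (Q : Matrix (Fin m) (Fin d) ℝ) (K V : Matrix (Fin n) (Fin d) ℝ)
    (β : ℝ) (r : ℕ) : ℝ≥0∞ :=
  (wildcat Q K V β r).expect fun O' => maxNorm (attention β Q K V - O')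

/-- For `n` keys of dimension `d n` and rank `r n`, on every input with any number `m` of queries and
whatever the random choices, WildCat takes at most `(m + n) n^{o(1)}` operations
(so `n^{1 + o(1)}` if `m = O(n)`). -/
def RunsInNearLinearTime (d r : ℕ → ℕ) : Prop :=
  ∃ e : ℕ → ℝ, e =o[atTop] (fun _ => (1 : ℝ)) ∧ ∀ᶠ n : ℕ in atTop,
    ∀ (m : ℕ) (β : ℝ) (Q : Matrix (Fin m) (Fin (d n)) ℝ) (K V : Matrix (Fin n) (Fin (d n)) ℝ),
      ∀ x ∈ (wildcat Q K V β (r n)).outcomes, (x.cost : ℝ) ≤ ((m : ℝ) + n) * (n : ℝ) ^ e n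

end WildCat

end

noncomputable section

namespace WildCat

/-! ## Positive semidefinite kernels -/

/-! Put `x = τ² q`. Then `h_τ(x, k_l - k̄) = exp(β⟨q, k_l - k̄⟩)`, so every attention weight is a
kernel value at a point outside the key set; the factor `exp(β⟨q, k̄⟩)` cancels on normalization.
The Nyström residual is therefore followed as a kernel on the whole space. Adding a pivot replaces
it by its Schur complement (`NysInvariant.update`), so it stays positive semidefinite and dominated
by `h_τ`. Cauchy–Schwarz bounds the error of each weight by `√(h_τ(x,x) · T)`, where `T` is the
trace of the residual on the keys. Stability of clipped averages then gives an output error of at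
most `‖V‖ n^{O(1)} √T` when `β R_Q R_K ≤ log n` (`maxNorm_attention_sub_outputOf_le`): the choice of
`τ` bounds `h_τ(x,x)` by a power of `n` and keeps the kernel exponents on the keys below `β R_Q
R_K`. It remains to make `E T` smaller than a prescribed power of `n`.

With residual matrix `R` on the keys, one round turns `T` into `T - ‖R‖_F² / T` in expectation. If
the kernel matrix is entrywise `ε`-close to a matrix of rank `k`, then `T ≤ n² ε + √k ‖R‖_F`
(`trace_le_of_low_rank`). Hence, with `η = n² ε`, the trace contracts by `1 - 1/(4k)` per round
until it reaches `2η` (`eexpect_foldlM_nysStep_le`).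

Low rank comes from Taylor polynomials of degree less than `N`: there are at most `N 2^{d+N}`
monomials, and the remainder is at most `2 G^N / N!`, where `G` bounds `β R_Q R_K`. For `G = O((log
n)^α)` this beats `n^{-C(1+|a|)}` once `N` is of order `(1+|a|) log n / log log n + (log
n)^{(1+α)/2}`. Since `a = o(log log n)`, this degree is `o(log n)`; together with `d = o(log n)` the
rank is `n^{o(1)}`, and so is the cost factor `(r+d+1)³`. The finitely many small `n` are handled by
the trivial approximation of rank `n`, with enough rounds. The second claim is the case `a = √(log
log n)`. -/

/-- A symmetric real kernel all of whose Gram matrices are positive semidefinite. -/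
structure IsPSDKernel {X : Type*} (ρ : X → X → ℝ) : Prop where
  symm : ∀ x y, ρ x y = ρ y x
  nonneg : ∀ (N : ℕ) (z : Fin N → X) (v : Fin N → ℝ),
    0 ≤ ∑ i, ∑ j, v i * v j * ρ (z i) (z j)

namespace IsPSDKernel

variable {X : Type*} {ρ : X → X → ℝ}

theorem diag_nonneg (h : IsPSDKernel ρ) (x : X) : 0 ≤ ρ x x := by
  simpa using h.nonneg 1 (fun _ => x) (fun _ => 1)

/-- The Cauchy–Schwarz inequality. -/
theorem sq_le (h : IsPSDKernel ρ) (x y : X) : ρ x y ^ 2 ≤ ρ x x * ρ y y := by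
  have key : ∀ t : ℝ, 0 ≤ ρ x x * (t * t) + (2 * ρ x y) * t + ρ y y := by
    intro t
    have := h.nonneg 2 ![x, y] ![t, 1]
    simp only [Fin.sum_univ_two, Matrix.cons_val_zero, Matrix.cons_val_one] at this
    rw [h.symm y x] at this
    linarith
  have := discrim_le_zero key
  rw [discrim] at this
  linarith

/-- The Schur complement of a positive semidefinite kernel. -/
theorem schur (h : IsPSDKernel ρ) {s : X} (hs : 0 < ρ s s) :
    IsPSDKernel fun x y => ρ x y - ρ s x * ρ s y / ρ s s := by
  refine ⟨fun x y => ?_, fun N z v => ?_⟩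
  · simp only [h.symm x y, mul_comm]
  · set b : ℝ := ∑ i, v i * ρ s (z i) with hb
    -- The weight `-b / ρ s s` at `s` minimizes the quadratic form in that coordinate; the minimum
    -- is the form of the Schur complement.
    have h1 := h.nonneg (N + 1) (Fin.cons s z) (Fin.cons (-b / ρ s s) v)
    simp only [Fin.sum_univ_succ, Fin.cons_zero, Fin.cons_succ, Finset.sum_add_distrib] at h1
    have e1 : ∑ i, -b / ρ s s * v i * ρ s (z i) = -b / ρ s s * b := by
      rw [hb, Finset.mul_sum]; exact Finset.sum_congr rfl fun i _ => by ring
    have e2 : ∑ i, v i * (-b / ρ s s) * ρ (z i) s = -b / ρ s s * b := by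
      rw [hb, Finset.mul_sum]; exact Finset.sum_congr rfl fun i _ => by rw [h.symm (z i) s]; ring
    have e3 : ∑ i, ∑ j, v i * v j * (ρ (z i) (z j) - ρ s (z i) * ρ s (z j) / ρ s s)
        = ∑ i, ∑ j, v i * v j * ρ (z i) (z j) - b * b / ρ s s := by
      rw [hb, Finset.sum_mul_sum, Finset.sum_div, ← Finset.sum_sub_distrib]
      refine Finset.sum_congr rfl fun i _ => ?_
      rw [Finset.sum_div, ← Finset.sum_sub_distrib]
      exact Finset.sum_congr rfl fun j _ => by ring
    rw [e1, e2] at h1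
    rw [e3]
    have e4 : -b / ρ s s * (-b / ρ s s) * ρ s s + -b / ρ s s * b = 0 := by
      field_simp; ring
    have e5 : -b / ρ s s * b = -(b * b / ρ s s) := by ring
    linarith

end IsPSDKernel

/-! ## The exponential kernel -/

/-- The exponential kernel `exp (c ⟨x, y⟩)`. -/
def expKernel {d : ℕ} (c : ℝ) (x y : Fin d → ℝ) : ℝ := Real.exp (c * ∑ i, x i * y i)

/-- Multi-indices of total degree less than `N` in `d` variables. -/
abbrev MonomialIndex (d N : ℕ) : Type := Σ j : Fin N, Sym (Fin d) j

theorem card_monomialIndex_le (d N : ℕ) :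
    Fintype.card (MonomialIndex d N) ≤ N * 2 ^ (d + N) := by
  rw [Fintype.card_sigma]
  calc ∑ j : Fin N, Fintype.card (Sym (Fin d) j)
      ≤ ∑ _j : Fin N, 2 ^ (d + N) := by
        refine Finset.sum_le_sum fun j _ => ?_
        rw [Sym.card_sym_eq_multichoose, Fintype.card_fin, Nat.multichoose_eq]
        exact (Nat.choose_le_two_pow _ _).trans (Nat.pow_le_pow_right (by norm_num) (by omega))
    _ = N * 2 ^ (d + N) := by simp

/-- The monomial with a given multi-index. -/
def monomialFeature {d N : ℕ} (f : MonomialIndex d N) (x : Fin d → ℝ) : ℝ :=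
  (f.2.val.map x).prod

/-- The coefficient of a monomial in the Taylor expansion of the exponential kernel. -/
def monomialWeight {d N : ℕ} (c : ℝ) (f : MonomialIndex d N) : ℝ :=
  c ^ (f.1 : ℕ) / (f.1 : ℕ).factorial * f.2.val.countPerms

theorem monomialWeight_nonneg {d N : ℕ} {c : ℝ} (hc : 0 ≤ c) (f : MonomialIndex d N) :
    0 ≤ monomialWeight c f := by unfold monomialWeight; positivity

/-- The multinomial theorem. It separates `x` from `y`, so the truncated series has rank at most the
number of monomials. -/
theorem sum_range_eq_sum_monomial {d : ℕ} (N : ℕ) (c : ℝ) (x y : Fin d → ℝ) :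
    ∑ j ∈ Finset.range N, (c * ∑ i, x i * y i) ^ j / (j.factorial : ℝ) =
      ∑ f : MonomialIndex d N,
        monomialWeight c f * (monomialFeature f x * monomialFeature f y) := by
  rw [Fintype.sum_sigma, Finset.sum_range]
  refine Finset.sum_congr rfl fun j _ => ?_
  rw [mul_pow, Finset.sum_pow, Finset.sym_univ, Finset.mul_sum, Finset.sum_div]
  refine Finset.sum_congr rfl fun m _ => ?_
  simp only [monomialWeight, monomialFeature, Multiset.prod_map_mul]
  ring

theorem tendsto_taylor_exp (z : ℝ) :
    Tendsto (fun N => ∑ j ∈ Finset.range N, z ^ j / (j.factorial : ℝ)) atTop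
      (nhds (Real.exp z)) := by
  rw [Real.exp_eq_exp_ℝ]
  exact (NormedSpace.expSeries_div_hasSum_exp z).tendsto_sum_nat

/-- Each Taylor polynomial gives a combination of squares with nonnegative weights, and
nonnegativity passes to the limit. -/
theorem isPSDKernel_expKernel {d : ℕ} {c : ℝ} (hc : 0 ≤ c) :
    IsPSDKernel (expKernel (d := d) c) := by
  refine ⟨fun x y => by simp only [expKernel, mul_comm], fun n z v => ?_⟩
  have ht : Tendsto (fun N => ∑ i, ∑ j, v i * v j *
      ∑ m ∈ Finset.range N, (c * ∑ e, z i e * z j e) ^ m / (m.factorial : ℝ)) atTop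
      (nhds (∑ i, ∑ j, v i * v j * expKernel c (z i) (z j))) :=
    tendsto_finsetSum _ fun i _ => tendsto_finsetSum _ fun j _ =>
      (tendsto_taylor_exp _).const_mul _
  refine ge_of_tendsto' ht fun N => ?_
  simp only [sum_range_eq_sum_monomial]
  simp only [Finset.mul_sum]
  have : ∑ i, ∑ j, ∑ f : MonomialIndex d N, v i * v j *
      (monomialWeight c f * (monomialFeature f (z i) * monomialFeature f (z j)))
      = ∑ f : MonomialIndex d N, monomialWeight c f * (∑ i, v i * monomialFeature f (z i)) ^ 2 := by
    rw [Finset.sum_congr rfl fun i _ => Finset.sum_comm, Finset.sum_comm]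
    refine Finset.sum_congr rfl fun f _ => ?_
    rw [sq, Finset.sum_mul_sum, Finset.mul_sum]
    refine Finset.sum_congr rfl fun i _ => ?_
    rw [Finset.mul_sum]
    exact Finset.sum_congr rfl fun j _ => by ring
  rw [this]
  exact Finset.sum_nonneg fun f _ => mul_nonneg (monomialWeight_nonneg hc f) (sq_nonneg _)

/-- Under `2x ≤ N + 1` consecutive terms of the tail shrink by at least a factor of two, so the tail
is at most twice its first term. -/
theorem abs_exp_sub_taylor_le {z x : ℝ} {N : ℕ} (hz : |z| ≤ x) (hx : 2 * x ≤ N + 1) :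
    |Real.exp z - ∑ j ∈ Finset.range N, z ^ j / (j.factorial : ℝ)|
      ≤ x ^ N / N.factorial * 2 := by
  have h := Complex.exp_bound' (x := (z : ℂ)) (n := N) (by
    rw [Complex.norm_real, Real.norm_eq_abs, div_le_iff₀ (by positivity)]
    push_cast
    linarith)
  rw [Complex.norm_real, Real.norm_eq_abs] at h
  have e : Complex.exp (z : ℂ) - ∑ m ∈ Finset.range N, (z : ℂ) ^ m / (m.factorial : ℂ)
      = ((Real.exp z - ∑ j ∈ Finset.range N, z ^ j / (j.factorial : ℝ) : ℝ) : ℂ) := by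
    push_cast; rfl
  rw [e, Complex.norm_real, Real.norm_eq_abs] at h
  refine h.trans ?_
  gcongr

/-! ## Traces of matrices dominated by a matrix of low rank -/

/-- Compute the trace in an orthonormal basis that extends one of the span `S` of the vectors `F f`.
A basis vector orthogonal to `S` does not see the low-rank part, so its share is at most that of `H
- ∑ F G`, hence at most `n ε`. At most `card ι` basis vectors lie in `S`; Cauchy–Schwarz bounds
their total share by the Frobenius norm. -/
theorem trace_le_of_low_rank {n : ℕ} {ι : Type*} [Fintype ι] (R H : Fin n → Fin n → ℝ)
    (F G : ι → Fin n → ℝ) {ε : ℝ}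
    (hRH : ∀ v : Fin n → ℝ, ∑ i, ∑ j, v i * v j * R i j ≤ ∑ i, ∑ j, v i * v j * H i j)
    (hε : ∀ i j, |H i j - ∑ f, F f i * G f j| ≤ ε) :
    ∑ i, R i i ≤ n ^ 2 * ε + Real.sqrt (Fintype.card ι * ∑ i, ∑ j, R i j ^ 2) := by
  classical
  have hin : ∀ a b : EuclideanSpace ℝ (Fin n), inner ℝ a b = ∑ i, a i * b i := by
    intro a b
    simp [PiLp.inner_apply, mul_comm]
  let S : Submodule ℝ (EuclideanSpace ℝ (Fin n)) := Submodule.span ℝ (Set.range fun f => (WithLp.toLp 2 (F f) : EuclideanSpace ℝ (Fin n)))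
  have hS : Module.finrank ℝ S ≤ Fintype.card ι := finrank_range_le_card _
  let b₀ := stdOrthonormalBasis ℝ S
  have ho : Orthonormal ℝ (fun i => (b₀ i : EuclideanSpace ℝ (Fin n))) := b₀.orthonormal.comp_linearIsometry S.subtypeₗᵢ
  have ho' : Orthonormal ℝ ((↑) : Set.range (fun i => (b₀ i : EuclideanSpace ℝ (Fin n))) → EuclideanSpace ℝ (Fin n)) := ho.toSubtypeRange
  obtain ⟨u, b, hub, hb⟩ := ho'.exists_orthonormalBasis_extension
  let row : Fin n → EuclideanSpace ℝ (Fin n) := fun i => WithLp.toLp 2 (R i)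
  have hcard : u.card = n := by
    have := Module.finrank_eq_card_basis b.toBasis
    simpa using this.symm
  have hq : ∀ x : EuclideanSpace ℝ (Fin n), ∑ i, x i * inner ℝ (row i) x = ∑ i, ∑ j, x i * x j * R i j := by
    intro x
    refine Finset.sum_congr rfl fun i _ => ?_
    rw [hin, Finset.mul_sum]
    exact Finset.sum_congr rfl fun j _ => by ring
  have hcoord : ∀ (x : EuclideanSpace ℝ (Fin n)) i, x i = inner ℝ (EuclideanSpace.single i (1 : ℝ)) x := by
    intro x i; simp [EuclideanSpace.inner_single_left]
  let q : EuclideanSpace ℝ (Fin n) → ℝ := fun x => ∑ i, x i * inner ℝ (row i) x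
  have htr : ∑ i, R i i = ∑ x : u, q x := by
    simp only [q]
    rw [Finset.sum_comm]
    refine Finset.sum_congr rfl fun i _ => ?_
    have := b.sum_inner_mul_inner (EuclideanSpace.single i (1 : ℝ)) (row i)
    rw [hb] at this
    rw [← hcoord] at this
    simp only [← hcoord] at this
    rw [show R i i = row i i from rfl, ← this]
    exact Finset.sum_congr rfl fun x _ => by rw [real_inner_comm]
  have hfro : ∑ x : u, q x ^ 2 ≤ ∑ i, ∑ j, R i j ^ 2 := by
    calc ∑ x : u, q x ^ 2 ≤ ∑ x : u, ∑ i, inner ℝ (row i) (x : EuclideanSpace ℝ (Fin n)) ^ 2 := by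
          refine Finset.sum_le_sum fun x _ => ?_
          have h1 := Finset.sum_mul_sq_le_sq_mul_sq Finset.univ (fun i => (x : EuclideanSpace ℝ (Fin n)) i)
            (fun i => inner ℝ (row i) (x : EuclideanSpace ℝ (Fin n)))
          have h2 : ∑ i, (x : EuclideanSpace ℝ (Fin n)) i ^ 2 = 1 := by
            rw [← EuclideanSpace.real_norm_sq_eq]
            have := b.orthonormal.1 x
            rw [hb] at this
            rw [this]; norm_num
          rwa [h2, one_mul] at h1
      _ = ∑ i, ∑ x : u, inner ℝ (row i) (x : EuclideanSpace ℝ (Fin n)) ^ 2 := Finset.sum_comm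
      _ = ∑ i, ∑ j, R i j ^ 2 := by
          refine Finset.sum_congr rfl fun i _ => ?_
          have := b.sum_sq_norm_inner_left (row i)
          rw [hb] at this
          simp only [Real.norm_eq_abs, sq_abs] at this
          rw [this, EuclideanSpace.real_norm_sq_eq]
  have hε0 : ∀ x : u, (x : EuclideanSpace ℝ (Fin n)) ∉ S → q x ≤ n * ε := by
    intro x hx
    have hort : ∀ f, ∑ i, F f i * (x : EuclideanSpace ℝ (Fin n)) i = 0 := by
      intro f
      -- The extended basis contains an orthonormal basis of `S`; a member outside `S` differs from
      -- all of those vectors and is thus orthogonal to them.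
      have hx' : (x : EuclideanSpace ℝ (Fin n)) ∈ Sᗮ := by
        rw [Submodule.mem_orthogonal]
        intro y hy
        have h0 : ∀ i, inner ℝ (b₀ i : EuclideanSpace ℝ (Fin n)) (x : EuclideanSpace ℝ (Fin n)) = 0 := by
          intro i
          have hi : (b₀ i : EuclideanSpace ℝ (Fin n)) ∈ u := hub ⟨i, rfl⟩
          have := b.orthonormal.2 (i := ⟨_, hi⟩) (j := x) (by
            intro h; apply hx; rw [← h]; exact (b₀ i).2)
          rwa [hb] at this
        have := b₀.sum_repr ⟨y, hy⟩
        have := congrArg (Subtype.val) this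
        simp only [Submodule.coe_sum, Submodule.coe_smul] at this
        rw [← this, sum_inner]
        exact Finset.sum_eq_zero fun i _ => by rw [real_inner_smul_left, h0, mul_zero]
      have := (Submodule.mem_orthogonal _ _).1 hx' (WithLp.toLp 2 (F f))
        (Submodule.subset_span ⟨f, rfl⟩)
      rwa [hin] at this
    have hnorm : ∑ i, (x : EuclideanSpace ℝ (Fin n)) i ^ 2 = 1 := by
      rw [← EuclideanSpace.real_norm_sq_eq]
      have := b.orthonormal.1 x
      rw [hb] at this
      rw [this]; norm_num
    set v : Fin n → ℝ := fun i => (x : EuclideanSpace ℝ (Fin n)) i with hv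
    have e0 : ∑ i, ∑ j, v i * v j * ∑ f, F f i * G f j = 0 := by
      have : ∀ i j, v i * v j * ∑ f, F f i * G f j = ∑ f, (F f i * v i) * (G f j * v j) := by
        intro i j; rw [Finset.mul_sum]; exact Finset.sum_congr rfl fun f _ => by ring
      simp only [this]
      rw [Finset.sum_congr rfl fun i _ => Finset.sum_comm, Finset.sum_comm]
      refine Finset.sum_eq_zero fun f _ => ?_
      rw [← Finset.sum_mul_sum, hort f, zero_mul]
    calc q x = ∑ i, ∑ j, v i * v j * R i j := hq x
      _ ≤ ∑ i, ∑ j, v i * v j * H i j := hRH v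
      _ = ∑ i, ∑ j, v i * v j * (H i j - ∑ f, F f i * G f j) := by
          simp only [mul_sub, Finset.sum_sub_distrib]
          rw [e0, sub_zero]
      _ ≤ ∑ i, ∑ j, |v i| * |v j| * ε := by
          refine Finset.sum_le_sum fun i _ => Finset.sum_le_sum fun j _ => ?_
          refine (le_abs_self _).trans ?_
          rw [abs_mul, abs_mul]
          exact mul_le_mul_of_nonneg_left (hε i j) (by positivity)
      _ = (∑ i, |v i|) ^ 2 * ε := by
          rw [sq, Finset.sum_mul_sum, Finset.sum_mul]
          exact Finset.sum_congr rfl fun i _ => by rw [Finset.sum_mul]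
      _ ≤ n * ε := by
          have h1 := Finset.sum_mul_sq_le_sq_mul_sq Finset.univ (fun i => |v i|) (fun _ => (1 : ℝ))
          simp only [mul_one, sq_abs, one_pow, Finset.sum_const, Finset.card_univ,
            Fintype.card_fin, nsmul_eq_mul] at h1
          rw [show ∑ i, v i ^ 2 = 1 from hnorm, one_mul] at h1
          rcases Nat.eq_zero_or_pos n with rfl | hn
          · simp
          · exact mul_le_mul_of_nonneg_right h1 ((abs_nonneg _).trans (hε ⟨0, hn⟩ ⟨0, hn⟩))
  have hcS : (Finset.univ.filter fun x : u => (x : EuclideanSpace ℝ (Fin n)) ∈ S).card ≤ Fintype.card ι := by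
    have hli : LinearIndependent ℝ
        (fun x : {x : u // (x : EuclideanSpace ℝ (Fin n)) ∈ S} => (⟨(x : u), x.2⟩ : S)) := by
      have h1 : LinearIndependent ℝ (fun x : {x : u // (x : EuclideanSpace ℝ (Fin n)) ∈ S} => ((x : u) : EuclideanSpace ℝ (Fin n))) := by
        have := b.orthonormal.linearIndependent
        rw [hb] at this
        exact this.comp (fun x : {x : u // (x : EuclideanSpace ℝ (Fin n)) ∈ S} => (x : u)) Subtype.val_injective
      exact LinearIndependent.of_comp S.subtype h1
    have := hli.fintype_card_le_finrank
    rw [Fintype.card_subtype] at this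
    exact this.trans hS
  rw [htr, ← Finset.sum_filter_add_sum_filter_not Finset.univ (fun x : u => (x : EuclideanSpace ℝ (Fin n)) ∈ S),
    add_comm]
  refine add_le_add ?_ ?_
  · calc _ ≤ ∑ _x ∈ Finset.univ.filter (fun x : u => (x : EuclideanSpace ℝ (Fin n)) ∉ S), (n : ℝ) * ε :=
          Finset.sum_le_sum fun x hx => hε0 x (Finset.mem_filter.1 hx).2
      _ = (Finset.univ.filter fun x : u => (x : EuclideanSpace ℝ (Fin n)) ∉ S).card * (n * ε) := by
          rw [Finset.sum_const, nsmul_eq_mul]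
      _ ≤ n * (n * ε) := by
          rcases Nat.eq_zero_or_pos n with h | hn
          · simp [h]
          · have h0 : 0 ≤ ε := (abs_nonneg _).trans (hε ⟨0, hn⟩ ⟨0, hn⟩)
            refine mul_le_mul_of_nonneg_right ?_ (by positivity)
            have := Finset.card_filter_le (Finset.univ : Finset u) (fun x => (x : EuclideanSpace ℝ (Fin n)) ∉ S)
            rw [Finset.card_univ, Fintype.card_coe, hcard] at this
            exact_mod_cast this
      _ = n ^ 2 * ε := by ring
  · refine Real.le_sqrt_of_sq_le ?_
    refine (sq_sum_le_card_mul_sum_sq).trans ?_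
    refine mul_le_mul (by exact_mod_cast hcS) ?_ (Finset.sum_nonneg fun _ _ => sq_nonneg _)
      (by positivity)
    refine le_trans ?_ hfro
    exact Finset.sum_le_sum_of_subset_of_nonneg (Finset.filter_subset _ _)
      fun _ _ _ => sq_nonneg _

/-! ## The Lambert function -/

theorem lambertW_spec {z : ℝ} (hz : 0 < z) :
    -1 < lambertW z ∧ lambertW z * Real.exp (lambertW z) = z := by
  have h : ∃ w : ℝ, -1 < w ∧ w * Real.exp w = z := by
    have hc : ContinuousOn (fun w : ℝ => w * Real.exp w) (Set.Icc 0 z) := by fun_prop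
    have := intermediate_value_Icc hz.le hc
    obtain ⟨w, hw, hwz⟩ := this (show z ∈ _ by
      simp only [zero_mul, Set.mem_Icc]
      refine ⟨hz.le, ?_⟩
      have := Real.one_le_exp hz.le
      nlinarith)
    exact ⟨w, by linarith [hw.1], hwz⟩
  unfold lambertW
  rw [dif_pos h]
  exact h.choose_spec

/-- If `w < 1`, then `z = w exp w ≤ e w`. A positive lower bound that does not depend on `n` is
enough for the temperature. -/
theorem min_le_lambertW {z z₀ : ℝ} (hz₀ : 0 < z₀) (hz : z₀ ≤ z) :
    min 1 (z₀ / Real.exp 1) ≤ lambertW z := by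
  obtain ⟨-, h2⟩ := lambertW_spec (hz₀.trans_le hz)
  by_contra! h
  have hw1 := h.trans_le (min_le_left _ _)
  have hw2 := h.trans_le (min_le_right _ _)
  have hpos : 0 < lambertW z := by
    by_contra! hneg
    have := mul_nonpos_of_nonpos_of_nonneg hneg (Real.exp_pos (lambertW z)).le
    linarith
  rw [lt_div_iff₀ (Real.exp_pos 1)] at hw2
  have : lambertW z * Real.exp (lambertW z) ≤ lambertW z * Real.exp 1 :=
    mul_le_mul_of_nonneg_left (Real.exp_le_exp.2 hw1.le) hpos.le
  linarith

theorem one_le_rhoZero : 1 ≤ rhoZero := by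
  unfold rhoZero
  rw [Real.one_le_sqrt]
  linarith [Real.exp_pos (lambertW (2 / Real.exp 1 ^ 2) + 2)]

section Algorithm

open Timed

/-! ## Expectations and operation counts of randomized computations -/

theorem tsum_pmf_pure_mul {α : Type*} (a : α) (F : α → ℝ≥0∞) :
    ∑' x, PMF.pure a x * F x = F a := by
  rw [tsum_eq_single a fun b hb => by simp [PMF.pure_apply, hb]]
  simp

theorem tsum_pmf_bind_mul {α β : Type*} (p : PMF α) (f : α → PMF β) (F : β → ℝ≥0∞) :
    ∑' y, p.bind f y * F y = ∑' x, p x * ∑' y, f x y * F y := by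
  simp only [PMF.bind_apply, ← ENNReal.tsum_mul_right, ← ENNReal.tsum_mul_left, mul_assoc]
  exact ENNReal.tsum_comm

theorem tsum_pmf_map_mul {α β : Type*} (p : PMF α) (f : α → β) (F : β → ℝ≥0∞) :
    ∑' y, p.map f y * F y = ∑' x, p x * F (f x) := by
  rw [PMF.map, tsum_pmf_bind_mul]
  simp only [Function.comp_apply, tsum_pmf_pure_mul]

namespace Rand

variable {α γ : Type}

/-- The expectation of an extended nonnegative function of the result. -/
def eexpect (p : Rand α) (F : α → ℝ≥0∞) : ℝ≥0∞ :=
  ∑' x : Timed α, (show PMF (Timed α) from p) x * F x.val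

theorem expect_eq_eexpect (p : Rand α) (f : α → ℝ) :
    p.expect f = p.eexpect fun a => ENNReal.ofReal (f a) := rfl

theorem eexpect_pure (a : α) (F : α → ℝ≥0∞) : (pure a : Rand α).eexpect F = F a :=
  tsum_pmf_pure_mul (⟨a, 0⟩ : Timed α) fun x => F x.val

theorem eexpect_lift (t : Timed α) (F : α → ℝ≥0∞) :
    (liftM t : Rand α).eexpect F = F t.val :=
  tsum_pmf_pure_mul t fun x => F x.val

/-- The integrand sees only the value, so the bookkeeping of operation counts drops out and
expectations compose as for ordinary kernels. -/
theorem eexpect_bind (p : Rand α) (f : α → Rand γ) (F : γ → ℝ≥0∞) :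
    (p >>= f).eexpect F = p.eexpect fun a => (f a).eexpect F := by
  refine (tsum_pmf_bind_mul (α := Timed α) (β := Timed γ) p _ fun x => F x.val).trans ?_
  refine tsum_congr fun x => ?_
  congr 1
  exact tsum_pmf_map_mul (α := Timed γ) (β := Timed γ) (f x.val) _ fun x => F x.val

theorem tsum_ofReal_ne_top {n : ℕ} (p : Fin n → ℝ) : ∑' l, ENNReal.ofReal (p l) ≠ ⊤ := by
  rw [tsum_fintype]; exact ENNReal.sum_ne_top.2 fun _ _ => ENNReal.ofReal_ne_top

theorem sample_of_ne_zero {n : ℕ} {p : Fin n → ℝ} (h : ∑' l, ENNReal.ofReal (p l) ≠ 0) :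
    (show PMF (Timed (Option (Fin n))) from sample p) =
      PMF.map (fun l => (⟨some l, 2 * n + 1⟩ : Timed (Option (Fin n))))
        (PMF.normalize (fun l => ENNReal.ofReal (p l)) h (tsum_ofReal_ne_top p)) := by
  classical exact dif_pos h

theorem sample_of_eq_zero {n : ℕ} {p : Fin n → ℝ} (h : ∑' l, ENNReal.ofReal (p l) = 0) :
    (show PMF (Timed (Option (Fin n))) from sample p) =
      PMF.pure (⟨none, 2 * n + 1⟩ : Timed (Option (Fin n))) := by
  classical exact dif_neg (not_not.2 h)

theorem eexpect_sample {n : ℕ} (p : Fin n → ℝ) (F : Option (Fin n) → ℝ≥0∞) :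
    (sample p).eexpect F = if ∑ l, ENNReal.ofReal (p l) = 0 then F none else
      ∑ l, ENNReal.ofReal (p l) * (∑ l, ENNReal.ofReal (p l))⁻¹ * F (some l) := by
  unfold eexpect
  by_cases h : ∑ l, ENNReal.ofReal (p l) = 0
  · rw [if_pos h, sample_of_eq_zero (by rwa [tsum_fintype])]
    exact tsum_pmf_pure_mul (⟨none, 2 * n + 1⟩ : Timed (Option (Fin n))) fun x => F x.val
  · rw [if_neg h, sample_of_ne_zero (by rwa [tsum_fintype])]
    refine (tsum_pmf_map_mul _ _ fun x : Timed (Option (Fin n)) => F x.val).trans ?_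
    rw [tsum_fintype]
    refine Finset.sum_congr rfl fun l _ => ?_
    rw [PMF.normalize_apply, tsum_fintype]

/-- Every outcome takes at most `c` operations. -/
def CostLE (p : Rand α) (c : ℕ) : Prop := ∀ x ∈ p.outcomes, x.cost ≤ c

theorem CostLE.mono {p : Rand α} {c c' : ℕ} (h : p.CostLE c) (hc : c ≤ c') : p.CostLE c' :=
  fun x hx => (h x hx).trans hc

theorem costLE_pure (a : α) : (pure a : Rand α).CostLE 0 := by
  intro x hx
  have hx' : x ∈ (PMF.pure (⟨a, 0⟩ : Timed α)).support := hx
  rw [PMF.mem_support_pure_iff] at hx'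
  rw [hx']

theorem costLE_lift {t : Timed α} {c : ℕ} (h : t.cost ≤ c) : (liftM t : Rand α).CostLE c := by
  intro x hx
  have hx' : x ∈ (PMF.pure t).support := hx
  rw [PMF.mem_support_pure_iff] at hx'
  rwa [hx']

theorem CostLE.bind {p : Rand α} {f : α → Rand γ} {a b : ℕ} (hp : p.CostLE a)
    (hf : ∀ x, (f x).CostLE b) : (p >>= f).CostLE (a + b) := by
  intro y hy
  have hy' : y ∈ (PMF.bind (show PMF (Timed α) from p) fun x =>
    PMF.map (fun y : Timed γ => (⟨y.val, x.cost + y.cost⟩ : Timed γ)) (f x.val)).support := hy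
  rw [PMF.mem_support_bind_iff] at hy'
  obtain ⟨x, hx, hxy⟩ := hy'
  obtain ⟨z, hz, rfl⟩ := (PMF.mem_support_map_iff (α := Timed γ) (β := Timed γ) _ _ _).1 hxy
  exact add_le_add (hp x hx) (hf x.val z hz)

theorem costLE_sample {n : ℕ} (p : Fin n → ℝ) : (sample p).CostLE (2 * n + 1) := by
  intro x hx
  unfold outcomes at hx
  by_cases h : ∑' l, ENNReal.ofReal (p l) = 0
  · rw [show PMF.support (sample p) = _ from congrArg PMF.support (sample_of_eq_zero h)] at hx
    rw [(PMF.mem_support_pure_iff _ _).1 hx]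
  · rw [show PMF.support (sample p) = _ from congrArg PMF.support (sample_of_ne_zero h)] at hx
    obtain ⟨l, -, rfl⟩ := (PMF.mem_support_map_iff _ _ _).1 hx
    exact le_rfl

theorem costLE_foldlM {σ τ : Type} {f : σ → τ → Rand σ} {c : ℕ} (h : ∀ s t, (f s t).CostLE c)
    (l : List τ) (s : σ) : (l.foldlM f s).CostLE (l.length * c) := by
  induction l generalizing s with
  | nil => simpa using costLE_pure s
  | cons t l ih =>
    rw [List.foldlM_cons]
    exact ((h s t).bind fun s' => ih s').mono (by rw [List.length_cons]; ring_nf; rfl)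

end Rand

/-! ## The state of randomly pivoted Nyström -/

section Nystrom

variable {n d r : ℕ} (K : Matrix (Fin n) (Fin d) ℝ) (h : (Fin d → ℝ) → (Fin d → ℝ) → Timed ℝ)

/-- The kernel section at the pivot in slot `j` (zero for an empty slot). -/
def slotFeature (S : Fin r → Option (Fin n)) (j : Fin r) (x : Fin d → ℝ) : ℝ :=
  match S j with
  | none => 0
  | some s => (h (K s) x).val

/-- The residual of the Nyström approximation, as a kernel on the whole space. -/
def residual (st : NysState n r) (x y : Fin d → ℝ) : ℝ :=
  (h x y).val - ∑ j, ∑ k, slotFeature K h st.S j x * st.M j k * slotFeature K h st.S k y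

/-- The invariant of randomly pivoted Nyström. -/
structure NysInvariant (st : NysState n r) : Prop where
  psd : IsPSDKernel (residual K h st)
  row : ∀ j l, st.R j l = slotFeature K h st.S j (K l)
  left_zero : ∀ j k, st.S j = none → st.M j k = 0
  right_zero : ∀ j k, st.S k = none → st.M j k = 0
  diag : ∀ l, st.p l = residual K h st (K l) (K l)
  dominated : ∀ (N : ℕ) (z : Fin N → Fin d → ℝ) (v : Fin N → ℝ),
    ∑ i, ∑ j, v i * v j * residual K h st (z i) (z j) ≤ ∑ i, ∑ j, v i * v j * (h (z i) (z j)).val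

variable {K h}

theorem nysUpdate_val (i : Fin r) (s : Fin n) (st : NysState n r) :
    (nysUpdate K h i s st).val =
      (let c := Real.sqrt (st.p s)
       let g : Fin r → ℝ := fun j => if j = i then -1 / c else (∑ k, st.M j k * st.R k s) / c
       let R := Function.update st.R i fun l => (h (K s) (K l)).val
       ⟨Function.update st.S i (some s), fun j k => st.M j k + g j * g k, R,
        Function.update (fun l => st.p l - (∑ j, g j * R j l) * ∑ j, g j * R j l) s 0⟩) := by
  have : ∀ (j : Fin r) (c : ℝ) (g₀ : ℝ),
      (if j = i then div (-1) c else div g₀ c : Timed ℝ).val = if j = i then -1 / c else g₀ / c := by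
    intro j c g₀; split_ifs <;> rfl
  simp only [← this]
  rfl

namespace NysInvariant

variable {st : NysState n r}

/-- Bordering the inverse by a new pivot adds the rank-one matrix `g gᵀ`, and `∑ g_j φ_j(x)` is the
old residual at the pivot divided by `-c`, where `c²` is its diagonal entry. Hence the residual
changes by exactly a Schur complement, from which all parts of the invariant follow. -/
theorem update (hst : NysInvariant K h st) (hsymm : ∀ x y, (h x y).val = (h y x).val)
    {i : Fin r} (hi : st.S i = none) {s : Fin n} (hs : 0 < st.p s) :
    NysInvariant K h (nysUpdate K h i s st).val ∧
      ∀ x y, residual K h (nysUpdate K h i s st).val x y =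
        residual K h st x y -
          residual K h st (K s) x * residual K h st (K s) y / residual K h st (K s) (K s) := by
  set c := Real.sqrt (st.p s) with hc
  have hcpos : 0 < c := Real.sqrt_pos.2 hs
  have hcc : c * c = residual K h st (K s) (K s) := by
    rw [← hst.diag, hc, Real.mul_self_sqrt hs.le]
  set g : Fin r → ℝ := fun j => if j = i then -1 / c else (∑ k, st.M j k * st.R k s) / c with hg
  set φ' : Fin r → (Fin d → ℝ) → ℝ := slotFeature K h (Function.update st.S i (some s)) with hφ'
  have hφi : ∀ x, φ' i x = (h (K s) x).val := by
    intro x; simp [hφ', slotFeature]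
  have hφj : ∀ j, j ≠ i → ∀ x, φ' j x = slotFeature K h st.S j x := by
    intro j hj x; simp [hφ', slotFeature, Function.update_of_ne hj]
  have hφ0 : ∀ x, slotFeature K h st.S i x = 0 := by
    intro x; simp [slotFeature, hi]
  have hrow : ∀ j l, Function.update st.R i (fun l => (h (K s) (K l)).val) j l = φ' j (K l) := by
    intro j l
    by_cases hj : j = i
    · subst hj; rw [Function.update_self, hφi]
    · rw [Function.update_of_ne hj, hφj j hj, hst.row]
  have hδ : ∀ x, ∑ j, g j * φ' j x = -residual K h st (K s) x / c := by
    intro x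
    have e1 : ∀ j, g j * φ' j x = (∑ k, slotFeature K h st.S j x * st.M j k *
        slotFeature K h st.S k (K s)) / c + if j = i then -(h (K s) x).val / c else 0 := by
      intro j
      by_cases hj : j = i
      · subst hj
        simp only [hg, if_true, hφi, hφ0, zero_mul, Finset.sum_const_zero, zero_div, zero_add]
        ring
      · simp only [hg, if_neg hj, hφj j hj, hst.row, add_zero]
        rw [div_mul_eq_mul_div, Finset.sum_mul]
        congr 1
        exact Finset.sum_congr rfl fun k _ => by ring
    rw [Finset.sum_congr rfl fun j _ => e1 j, Finset.sum_add_distrib, Finset.sum_ite_eq',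
      if_pos (Finset.mem_univ _), hst.psd.symm, residual, ← Finset.sum_div, hsymm (K s) x]
    ring
  have hres : ∀ x y, residual K h (nysUpdate K h i s st).val x y =
        residual K h st x y -
          residual K h st (K s) x * residual K h st (K s) y / residual K h st (K s) (K s) := by
    intro x y
    rw [nysUpdate_val]
    simp only [residual]
    have e2 : ∀ j k, φ' j x * (st.M j k + g j * g k) * φ' k y =
        slotFeature K h st.S j x * st.M j k * slotFeature K h st.S k y +
          (g j * φ' j x) * (g k * φ' k y) := by
      intro j k
      -- Filling slot `i` alters only the feature `φ i`, and there the old `M` has a zero row and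
      -- column.
      have : φ' j x * st.M j k * φ' k y =
          slotFeature K h st.S j x * st.M j k * slotFeature K h st.S k y := by
        by_cases hj : j = i
        · subst hj; rw [hst.left_zero _ _ hi]; ring
        by_cases hk : k = i
        · subst hk; rw [hst.right_zero _ _ hi]; ring
        rw [hφj j hj, hφj k hk]
      linear_combination this
    rw [Finset.sum_congr rfl fun j _ => Finset.sum_congr rfl fun k _ => e2 j k]
    simp only [Finset.sum_add_distrib]
    rw [← Finset.sum_mul_sum, hδ, hδ, ← sub_sub]
    congr 1
    change _ = residual K h st (K s) x * residual K h st (K s) y / residual K h st (K s) (K s)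
    rw [← hcc]
    field_simp
  have hss : 0 < residual K h st (K s) (K s) := by rw [← hcc]; positivity
  have hfun : residual K h (nysUpdate K h i s st).val = fun x y => residual K h st x y -
          residual K h st (K s) x * residual K h st (K s) y / residual K h st (K s) (K s) := by
    funext x y; exact hres x y
  refine ⟨⟨?_, ?_, ?_, ?_, ?_, ?_⟩, hres⟩
  · rw [hfun]; exact hst.psd.schur hss
  · intro j l
    rw [nysUpdate_val]
    exact hrow j l
  · intro j k hj
    have hji : j ≠ i := by
      rintro rfl; rw [nysUpdate_val] at hj; simp at hj
    have hj' : st.S j = none := by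
      rw [nysUpdate_val] at hj; simpa [Function.update_of_ne hji] using hj
    rw [nysUpdate_val]
    simp only [hst.left_zero j _ hj', if_neg hji, zero_mul, Finset.sum_const_zero, zero_div,
      add_zero]
  · intro j k hj
    have hji : k ≠ i := by
      rintro rfl; rw [nysUpdate_val] at hj; simp at hj
    have hj' : st.S k = none := by
      rw [nysUpdate_val] at hj; simpa [Function.update_of_ne hji] using hj
    rw [nysUpdate_val]
    simp only [hst.left_zero k _ hj', hst.right_zero _ k hj', if_neg hji, zero_mul,
      Finset.sum_const_zero, zero_div, mul_zero, add_zero]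
  · intro l
    rw [hres, nysUpdate_val]
    -- The Schur complement vanishes at its own pivot, in agreement with the `0` that the algorithm
    -- stores.
    by_cases hl : l = s
    · subst hl
      simp only [Function.update_self]
      field_simp
      ring
    · simp only [Function.update_of_ne hl]
      simp only [hrow]
      change st.p l - (∑ j, g j * φ' j (K l)) * (∑ j, g j * φ' j (K l)) = _
      rw [hδ, hst.diag, ← hcc]
      field_simp
  · intro N z v
    refine le_trans ?_ (hst.dominated N z v)
    have : ∑ a, ∑ b, v a * v b * residual K h (nysUpdate K h i s st).val (z a) (z b) =
        ∑ a, ∑ b, v a * v b * residual K h st (z a) (z b) -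
        (∑ a, v a * residual K h st (K s) (z a)) ^ 2 / residual K h st (K s) (K s) := by
      rw [sq, Finset.sum_mul_sum, Finset.sum_div, ← Finset.sum_sub_distrib]
      refine Finset.sum_congr rfl fun a _ => ?_
      rw [Finset.sum_div, ← Finset.sum_sub_distrib]
      exact Finset.sum_congr rfl fun b _ => by rw [hres]; ring
    rw [this]
    have : 0 ≤ (∑ a, v a * residual K h st (K s) (z a)) ^ 2 / residual K h st (K s) (K s) := by
      positivity
    linarith

theorem p_nonneg (hst : NysInvariant K h st) (l : Fin n) : 0 ≤ st.p l := by
  rw [hst.diag]; exact hst.psd.diag_nonneg _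

end NysInvariant

theorem nysUpdate_S (i j : Fin r) (hj : j ≠ i) (s : Fin n) (st : NysState n r) :
    (nysUpdate K h i s st).val.S j = st.S j := by
  rw [nysUpdate_val]; exact Function.update_of_ne hj _ _

/-- One round contracts the residual trace up to the error of the best low-rank approximation. -/
theorem eexpect_nysStep_le (hsymm : ∀ x y, (h x y).val = (h y x).val) {k η : ℝ} (hk : 1 ≤ k)
    (hη : 0 ≤ η)
    (htrace : ∀ st : NysState n r, NysInvariant K h st →
      ∑ l, st.p l ≤ η + Real.sqrt (k * ∑ l, ∑ l', residual K h st (K l) (K l') ^ 2))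
    {st : NysState n r} (hst : NysInvariant K h st) {i : Fin r} (hi : st.S i = none)
    {A B : ℝ} (hA : 0 ≤ A) (hB : 0 ≤ B) {F : NysState n r → ℝ≥0∞}
    (hF : ∀ st' : NysState n r, NysInvariant K h st' → (∀ j, j ≠ i → st'.S j = st.S j) →
      F st' ≤ ENNReal.ofReal (A + B * ∑ l, st'.p l)) :
    (nysStep K h st i).eexpect F ≤
      ENNReal.ofReal (A + B * ((1 - 1 / (4 * k)) * ∑ l, st.p l + 1 / (4 * k) * (2 * η))) := by
  have hp := hst.p_nonneg
  have hk0 : 0 < k := by linarith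
  unfold nysStep
  rw [Rand.eexpect_bind, Rand.eexpect_sample]
  have hsum : ∑ l, ENNReal.ofReal (st.p l) = ENNReal.ofReal (∑ l, st.p l) :=
    (ENNReal.ofReal_sum_of_nonneg fun l _ => hp l).symm
  set T := ∑ l, st.p l with hT
  have hT0 : 0 ≤ T := Finset.sum_nonneg fun l _ => hp l
  split_ifs with h0
  · have hTz : T = 0 := le_antisymm (ENNReal.ofReal_eq_zero.1 (hsum ▸ h0)) hT0
    refine (Rand.eexpect_pure st F).le.trans ((hF st hst fun _ _ => rfl).trans ?_)
    rw [← hT, hTz]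
    refine ENNReal.ofReal_le_ofReal ?_
    have : 0 ≤ B * (1 / (4 * k) * (2 * η)) := by positivity
    linarith
  · have hTpos : 0 < T := by
      rcases hT0.lt_or_eq with h | h
      · exact h
      · exact absurd (by rw [hsum, ← h, ENNReal.ofReal_zero]) h0
    set ρ := residual K h st with hρ
    set Fr := ∑ l, ∑ l', ρ (K l) (K l') ^ 2 with hFr
    -- A pivot of weight zero would break the invariant, but it contributes nothing; for the others
    -- the factor `p s` cancels the denominator of the Schur complement.
    have hterm : ∀ s, ENNReal.ofReal (st.p s) * (∑ l, ENNReal.ofReal (st.p l))⁻¹ *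
        F (nysUpdate K h i s st).val ≤ ENNReal.ofReal
          (st.p s / T * (A + B * T) - B / T * ∑ l, ρ (K s) (K l) ^ 2) := by
      intro s
      rcases (hp s).lt_or_eq with hs | hs
      · obtain ⟨h1, h2⟩ := hst.update hsymm hi hs
        have h3 := hF _ h1 fun j hj => nysUpdate_S i j hj s st
        rw [hsum, ← ENNReal.ofReal_inv_of_pos hTpos, ← ENNReal.ofReal_mul hs.le]
        refine (mul_le_mul_right h3 _).trans ?_
        rw [← ENNReal.ofReal_mul (by positivity)]
        refine ENNReal.ofReal_le_ofReal (le_of_eq ?_)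
        have h4 : ∑ l, (nysUpdate K h i s st).val.p l =
            T - (∑ l, ρ (K s) (K l) ^ 2) / st.p s := by
          rw [hT, Finset.sum_div, ← Finset.sum_sub_distrib]
          refine Finset.sum_congr rfl fun l _ => ?_
          rw [h1.diag, h2, ← hst.diag, ← hst.diag, ← hρ, sq]
        rw [h4]
        field_simp
        ring
      · rw [← hs, ENNReal.ofReal_zero, zero_mul, zero_mul]
        exact zero_le
    -- Signs are needed to pull the sum inside `ENNReal.ofReal`; they come from Cauchy–Schwarz for
    -- the residual.
    have hnn : ∀ s ∈ Finset.univ,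
        0 ≤ st.p s / T * (A + B * T) - B / T * ∑ l, ρ (K s) (K l) ^ 2 := by
      intro s _
      have : ∑ l, ρ (K s) (K l) ^ 2 ≤ st.p s * T := by
        rw [hT, Finset.mul_sum]
        refine Finset.sum_le_sum fun l _ => ?_
        rw [hst.diag, hst.diag]
        exact hst.psd.sq_le _ _
      have h5 : B / T * ∑ l, ρ (K s) (K l) ^ 2 ≤ B / T * (st.p s * T) :=
        mul_le_mul_of_nonneg_left this (by positivity)
      have h6 : st.p s / T * (A + B * T) = st.p s / T * A + B / T * (st.p s * T) := by
        field_simp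
      have h7 : 0 ≤ st.p s / T * A := mul_nonneg (div_nonneg (hp s) hT0) hA
      linarith
    have hsome : ∀ s, Rand.eexpect (match some s with
        | none => (pure st : Rand (NysState n r))
        | some s => liftM (nysUpdate K h i s st)) F = F (nysUpdate K h i s st).val :=
      fun s => Rand.eexpect_lift _ F
    calc _ ≤ ∑ s, ENNReal.ofReal
          (st.p s / T * (A + B * T) - B / T * ∑ l, ρ (K s) (K l) ^ 2) := by
          refine Finset.sum_le_sum fun s _ => ?_
          refine le_trans (le_of_eq ?_) (hterm s)
          congr 1
          exact hsome s
      _ = ENNReal.ofReal (∑ s,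
          (st.p s / T * (A + B * T) - B / T * ∑ l, ρ (K s) (K l) ^ 2)) :=
          (ENNReal.ofReal_sum_of_nonneg hnn).symm
      _ ≤ _ := by
          refine ENNReal.ofReal_le_ofReal ?_
          rw [Finset.sum_sub_distrib, ← Finset.sum_mul, ← Finset.sum_div, ← hT, ← Finset.mul_sum,
            ← hFr, div_self hTpos.ne', one_mul]
          have hFr0 : 0 ≤ Fr := Finset.sum_nonneg fun _ _ => Finset.sum_nonneg fun _ _ => sq_nonneg _
          have key : T - Fr / T ≤ (1 - 1 / (4 * k)) * T + 1 / (4 * k) * (2 * η) := by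
            have hTη := htrace st hst
            rw [← hT, ← hρ, ← hFr] at hTη
            have hkF : Real.sqrt (k * Fr) ^ 2 = k * Fr := Real.sq_sqrt (by positivity)
            -- Above `2η` the low-rank bound gives `T / 2 ≤ √(k Fr)`, hence a loss of at least `T /
            -- (4k)`. Below `2η` no progress is needed, since the claimed bound is a convex
            -- combination of `T` and `2η`.
            by_cases hcase : 2 * η ≤ T
            · have h8 : (T / 2) ^ 2 ≤ k * Fr := by
                rw [← hkF]
                exact pow_le_pow_left₀ (by positivity) (by linarith) 2
              have h9 : T / (4 * k) ≤ Fr / T := by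
                rw [div_le_div_iff₀ (by positivity) hTpos]
                nlinarith
              have h10 : 0 ≤ 1 / (4 * k) * (2 * η) := by positivity
              have h11 : (1 - 1 / (4 * k)) * T = T - T / (4 * k) := by ring
              linarith
            · push Not at hcase
              have h8 : 0 ≤ Fr / T := by positivity
              have h9 : 1 / (4 * k) * T ≤ 1 / (4 * k) * (2 * η) :=
                mul_le_mul_of_nonneg_left hcase.le (by positivity)
              linarith
          have := mul_le_mul_of_nonneg_left key hB
          have h12 : B / T * Fr = B * (Fr / T) := by ring
          rw [h12]
          linarith

/-- The rounds of randomly pivoted Nyström shrink the residual trace geometrically. -/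
theorem eexpect_foldlM_nysStep_le (hsymm : ∀ x y, (h x y).val = (h y x).val) {k η : ℝ} (hk : 1 ≤ k)
    (hη : 0 ≤ η)
    (htrace : ∀ st : NysState n r, NysInvariant K h st →
      ∑ l, st.p l ≤ η + Real.sqrt (k * ∑ l, ∑ l', residual K h st (K l) (K l') ^ 2))
    {A B : ℝ} (hA : 0 ≤ A) (hB : 0 ≤ B) {F : NysState n r → ℝ≥0∞}
    (hF : ∀ st' : NysState n r, NysInvariant K h st' →
      F st' ≤ ENNReal.ofReal (A + B * ∑ l, st'.p l))
    (L : List (Fin r)) (hL : L.Nodup) {st : NysState n r} (hst : NysInvariant K h st)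
    (hS : ∀ i ∈ L, st.S i = none) :
    (L.foldlM (nysStep K h) st).eexpect F ≤ ENNReal.ofReal (A + B *
      ((1 - 1 / (4 * k)) ^ L.length * ∑ l, st.p l +
        (1 - (1 - 1 / (4 * k)) ^ L.length) * (2 * η))) := by
  induction L generalizing st with
  | nil =>
    rw [List.foldlM_nil, Rand.eexpect_pure]
    simpa using hF st hst
  | cons i L ih =>
    rw [List.foldlM_cons, Rand.eexpect_bind]
    rw [List.nodup_cons] at hL
    have hk' : 1 / (4 * k) ≤ 1 := by
      rw [div_le_one (by linarith)]; linarith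
    have hq : 0 ≤ 1 - 1 / (4 * k) := by linarith
    have hq1 : (1 - 1 / (4 * k)) ^ L.length ≤ 1 :=
      pow_le_one₀ hq (by have : 0 ≤ 1 / (4 * k) := by positivity
                         linarith)
    set q := 1 - 1 / (4 * k) with hqd
    -- Affine functions of the trace are preserved: by induction the remaining rounds turn `A + B T`
    -- into another affine bound, to which the first round is applied. The list has no duplicates,
    -- so the slots of later rounds are still empty.
    refine (eexpect_nysStep_le hsymm hk hη htrace hst (hS i List.mem_cons_self)
      (A := A + B * ((1 - q ^ L.length) * (2 * η))) (B := B * q ^ L.length)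
      (by have := sub_nonneg.2 hq1; positivity) (by positivity) ?_).trans ?_
    · intro st' hst' hS'
      refine (ih hL.2 hst' fun j hj => ?_).trans (le_of_eq ?_)
      · rw [hS' j (by rintro rfl; exact hL.1 hj)]
        exact hS j (List.mem_cons_of_mem _ hj)
      · congr 1; ring
    · refine ENNReal.ofReal_le_ofReal (le_of_eq ?_)
      rw [List.length_cons, pow_succ]
      have : 1 / (4 * k) = 1 - q := by rw [hqd]; ring
      rw [this]
      ring

end Nystrom

/-! ## The result of WildCat as a function of the final Nyström state -/

section Output

variable {m n d : ℕ}

/-- The state before the first round. -/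
def nysInit (K : Matrix (Fin n) (Fin d) ℝ) (h : (Fin d → ℝ) → (Fin d → ℝ) → Timed ℝ) (r : ℕ) :
    NysState n r :=
  ⟨fun _ => none, fun _ _ => 0, fun _ _ => 0, fun l => (h (K l) (K l)).val⟩

/-- The mean of the keys. -/
def keyMean (K : Matrix (Fin n) (Fin d) ℝ) (j : Fin d) : ℝ := (∑ l, K l j) / n

/-- The Nyström weights of a state. -/
def nysWeights {r : ℕ} (st : NysState n r) (i : Fin r) (l : Fin n) : ℝ :=
  ∑ k, st.M i k * st.R k l

/-- The coreset keys of a state. -/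
def coresetKeys {r : ℕ} (K : Matrix (Fin n) (Fin d) ℝ) (st : NysState n r) (i : Fin r)
    (j : Fin d) : ℝ :=
  (match st.S i with | none => 0 | some s => recentred K s j) + keyMean K j

/-- The temperature that WildCat uses. -/
def temperature (β : ℝ) (Q : Matrix (Fin m) (Fin d) ℝ) (K : Matrix (Fin n) (Fin d) ℝ) : ℝ :=
  (getTemperature β (rowNorm Q) (rowNorm (recentred K)) n).val

open Classical in
/-- The output of WildCat for a given final state. -/
def outputOf {r : ℕ} (Q : Matrix (Fin m) (Fin d) ℝ) (K V : Matrix (Fin n) (Fin d) ℝ) (β : ℝ)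
    (st : NysState n r) : Matrix (Fin m) (Fin d) ℝ := fun i j =>
  let A := fun s => Real.exp (β * ∑ c, Q i c * coresetKeys K st s c)
  let D := ∑ s, A s * ∑ l, nysWeights st s l
  max (⨅ l, V l j) (min (if 0 < D then (∑ s, A s * ∑ l, nysWeights st s l * V l j) / D else 0)
    (⨆ l, V l j))

theorem radius_val {n d : ℕ} (A : Matrix (Fin n) (Fin d) ℝ) : (radius A).val = rowNorm A := by
  change (⨆ i, Real.sqrt (∑ j, A i j * A i j)) = _
  simp only [rowNorm, sq]

theorem wtdAttn_val {r : ℕ} (Q : Matrix (Fin m) (Fin d) ℝ) (K V : Matrix (Fin n) (Fin d) ℝ)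
    (β : ℝ) (st : NysState n r) :
    (wtdAttn Q (coresetKeys K st) (fun s j => ∑ l, nysWeights st s l * V l j)
      (fun s => ∑ l, nysWeights st s l) (fun j => ⨅ l, V l j) (fun j => ⨆ l, V l j) β).val =
      outputOf Q K V β st := by
  classical
  have key : ∀ (D x lo hi : ℝ), (do
      let o ← if (← isPos D) then div x D else (pure 0 : Timed ℝ)
      Timed.max lo (← Timed.min o hi)).val = Max.max lo (Min.min (if 0 < D then x / D else 0) hi) := by
    intro D x lo hi
    rw [show ∀ f : Bool → Timed ℝ, (isPos D >>= f).val = (f (decide (0 < D))).val from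
      fun _ => rfl]
    by_cases h : 0 < D
    · simp only [h, decide_true, if_true]; rfl
    · simp only [h, decide_false, if_false]; rfl
  funext i j
  simp only [outputOf, ← key]
  rfl

theorem eexpect_rpNys (K : Matrix (Fin n) (Fin d) ℝ) (h : (Fin d → ℝ) → (Fin d → ℝ) → Timed ℝ)
    (r : ℕ) (F : Matrix (Fin r) (Fin d) ℝ × Matrix (Fin r) (Fin n) ℝ → ℝ≥0∞) :
    (rpNys K h r).eexpect F =
      ((List.finRange r).foldlM (nysStep K h) (nysInit K h r)).eexpect fun st =>
        F (fun i j => match st.S i with | none => 0 | some s => K s j, nysWeights st) := by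
  unfold rpNys
  simp only [Rand.eexpect_bind, Rand.eexpect_lift, Rand.eexpect_pure]
  rfl

theorem eexpect_compressKV (K V : Matrix (Fin n) (Fin d) ℝ) (RQ β : ℝ) (r : ℕ)
    (F : Matrix (Fin r) (Fin d) ℝ × Matrix (Fin r) (Fin d) ℝ × (Fin r → ℝ) → ℝ≥0∞) :
    (compressKV K V RQ β r).eexpect F =
      ((List.finRange r).foldlM
        (nysStep (recentred K) (kernel β (getTemperature β RQ (rowNorm (recentred K)) n).val))
        (nysInit (recentred K)
          (kernel β (getTemperature β RQ (rowNorm (recentred K)) n).val) r)).eexpect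
        fun st => F (coresetKeys K st, fun s j => ∑ l, nysWeights st s l * V l j,
          fun s => ∑ l, nysWeights st s l) := by
  unfold compressKV
  simp only [Rand.eexpect_bind, Rand.eexpect_lift, Rand.eexpect_pure]
  rw [← radius_val]
  exact eexpect_rpNys (recentred K) _ r _

/-- All randomness sits in the pivot rounds; the rest is deterministic, so the error can be studied
one final state at a time. -/
theorem expectedError_eq (Q : Matrix (Fin m) (Fin d) ℝ) (K V : Matrix (Fin n) (Fin d) ℝ)
    (β : ℝ) (r : ℕ) :
    expectedError Q K V β r =
      ((List.finRange r).foldlM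
        (nysStep (recentred K) (kernel β (temperature β Q K)))
        (nysInit (recentred K) (kernel β (temperature β Q K)) r)).eexpect fun st =>
          ENNReal.ofReal (maxNorm (attention β Q K V - outputOf Q K V β st)) := by
  unfold expectedError wildcat
  rw [Rand.expect_eq_eexpect]
  simp only [Rand.eexpect_bind, Rand.eexpect_lift, ← wtdAttn_val]
  rw [radius_val]
  exact eexpect_compressKV K V _ β r _

end Output

/-! ## The operation count of WildCat -/

namespace Timed

variable {α γ : Type} {k : ℕ}

theorem cost_bind (x : Timed α) (f : α → Timed γ) :
    (x >>= f).cost = x.cost + (f x.val).cost := rfl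

theorem cost_pure (a : α) : (pure a : Timed α).cost = 0 := rfl

theorem cost_vec (f : Fin k → Timed α) : (vec f).cost = ∑ i, ((f i).cost + 1) := rfl

theorem cost_sum (f : Fin k → Timed ℝ) : (sum f).cost = ∑ i, ((f i).cost + 1) := rfl

theorem cost_maxOver (f : Fin k → Timed ℝ) : (maxOver f).cost = ∑ i, ((f i).cost + 1) := rfl

theorem cost_minOver (f : Fin k → Timed ℝ) : (minOver f).cost = ∑ i, ((f i).cost + 1) := rfl

theorem cost_add (x y : ℝ) : (add x y).cost = 1 := rfl
theorem cost_sub (x y : ℝ) : (sub x y).cost = 1 := rfl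
theorem cost_mul (x y : ℝ) : (mul x y).cost = 1 := rfl
theorem cost_div (x y : ℝ) : (div x y).cost = 1 := rfl
theorem cost_sqrt (x : ℝ) : (sqrt x).cost = 1 := rfl
theorem cost_exp (x : ℝ) : (exp x).cost = 1 := rfl
theorem cost_min (x y : ℝ) : (Timed.min x y).cost = 1 := rfl
theorem cost_max (x y : ℝ) : (Timed.max x y).cost = 1 := rfl
theorem cost_isPos (x : ℝ) : (isPos x).cost = 1 := rfl

end Timed

section Cost

variable {m n d r : ℕ}

theorem cost_kernel (β τ : ℝ) (x y : Fin d → ℝ) : (kernel β τ x y).cost = d * 2 + 4 := by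
  simp [kernel, dot, cost_bind, cost_sum, cost_mul, cost_div, cost_exp]

theorem cost_radius (A : Matrix (Fin n) (Fin d) ℝ) : (radius A).cost = n * (d * 2 + 2) := by
  simp [radius, dot, cost_maxOver, cost_bind, cost_sum, cost_mul, cost_sqrt]

theorem cost_nysUpdate (K : Matrix (Fin n) (Fin d) ℝ) (β τ : ℝ) (i : Fin r)
    (s : Fin n) (st : NysState n r) :
    (nysUpdate K (kernel β τ) i s st).cost = r * (r * 2 + 1) + (1 + (r * 2 +
      (r * (r * 3 + 1) + (n * (d * 2 + 5) + (n * (r * 2 + 1) + n * 3))))) := by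
  simp [nysUpdate, cost_bind, cost_vec, cost_sum, cost_mul, cost_div, cost_sqrt, cost_add,
    cost_sub, cost_kernel, cost_pure, apply_ite Timed.cost]

theorem costLE_nysStep (K : Matrix (Fin n) (Fin d) ℝ) (β τ : ℝ)
    (st : NysState n r) (i : Fin r) : (nysStep K (kernel β τ) st i).CostLE
      (20 * (n + r + 1) * (r + d + 1)) := by
  unfold nysStep
  refine ((Rand.costLE_sample _).bind fun x => ?_ : Rand.CostLE _ (_ + (r * (r * 2 + 1) +
    (1 + (r * 2 + (r * (r * 3 + 1) + (n * (d * 2 + 5) + (n * (r * 2 + 1) + n * 3)))))))).mono ?_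
  · cases x with
    | none => exact (Rand.costLE_pure st).mono (Nat.zero_le _)
    | some s => exact Rand.costLE_lift (cost_nysUpdate K β τ i s st).le
  -- Both sides become polynomials with natural coefficients, and `omega` compares them with the
  -- monomials as atoms.
  · ring_nf
    omega

theorem costLE_rpNys (K : Matrix (Fin n) (Fin d) ℝ) (β τ : ℝ) (r : ℕ) :
    (rpNys K (kernel β τ) r).CostLE (30 * (n + r + 1) * (r + d + 1) * (r + 1)) := by
  unfold rpNys
  have hfold := Rand.costLE_foldlM (costLE_nysStep K β τ (r := r)) (List.finRange r)
  rw [List.length_finRange] at hfold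
  refine Rand.CostLE.mono ((Rand.costLE_lift (c := n * (d * 2 + 5)) ?_).bind fun _ =>
    (Rand.costLE_lift (c := r * (r + 1)) ?_).bind fun _ =>
    (Rand.costLE_lift (c := r * (n + 1)) ?_).bind fun _ =>
    (hfold _).bind fun _ =>
    (Rand.costLE_lift (c := r * (d + 1)) ?_).bind fun _ =>
    (Rand.costLE_lift (c := r * (n * (r * 2 + 1) + 1)) ?_).bind fun _ => Rand.costLE_pure _) ?_
  iterate 5 simp [cost_vec, cost_sum, cost_mul, cost_kernel, cost_pure]
  ring_nf
  omega

theorem costLE_compressKV (K V : Matrix (Fin n) (Fin d) ℝ) (RQ β : ℝ) (r : ℕ) :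
    (compressKV K V RQ β r).CostLE (60 * (n + r + 1) * (r + d + 1) * (r + d + 1)) := by
  unfold compressKV
  refine Rand.CostLE.mono ((Rand.costLE_lift (c := d * (n + 2)) ?_).bind fun _ =>
    (Rand.costLE_lift (c := n * (d * 2 + 1)) ?_).bind fun _ =>
    (Rand.costLE_lift (cost_radius _).le).bind fun _ =>
    (Rand.costLE_lift (c := 13) (le_of_eq rfl)).bind fun _ =>
    (costLE_rpNys _ _ _ r).bind fun _ =>
    (Rand.costLE_lift (c := r * (d * 2 + 1)) ?_).bind fun _ =>
    (Rand.costLE_lift (c := r * (d * (n * 2 + 1) + 1)) ?_).bind fun _ =>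
    (Rand.costLE_lift (c := r * (n + 1)) ?_).bind fun _ => Rand.costLE_pure _) ?_
  iterate 5 simp [cost_vec, cost_sum, cost_mul, cost_pure, cost_bind, cost_add, cost_sub, cost_div]
  ring_nf
  omega

theorem cost_wtdAttn (Q : Matrix (Fin m) (Fin d) ℝ) (KS VS : Matrix (Fin r) (Fin d) ℝ)
    (w : Fin r → ℝ) (vmin vmax : Fin d → ℝ) (β : ℝ) :
    (wtdAttn Q KS VS w vmin vmax β).cost ≤ m * (r * (d * 2 + 3) + 1) +
      (m * (r * 2 + 1) + m * (d * (r * 2 + 5) + 1)) := by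
  simp only [wtdAttn, dot, cost_bind, cost_vec, cost_sum, cost_mul, cost_exp, cost_isPos]
  refine add_le_add (by simp) (add_le_add (by simp) ?_)
  refine (Finset.sum_le_card_nsmul _ _ _ fun i _ => Nat.add_le_add_right
    (Finset.sum_le_card_nsmul _ _ (r * 2 + 5) fun j _ => ?_) 1).trans (by simp)
  split_ifs <;> simp [cost_bind, cost_min, cost_max, cost_div, cost_pure]

theorem costLE_wildcat (Q : Matrix (Fin m) (Fin d) ℝ) (K V : Matrix (Fin n) (Fin d) ℝ) (β : ℝ)
    (hn : 1 ≤ n) (r : ℕ) :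
    (wildcat Q K V β r).CostLE (300 * (m + n) * (r + d + 1) ^ 3) := by
  unfold wildcat
  refine Rand.CostLE.mono ((Rand.costLE_lift (c := d * (n + 1)) ?_).bind fun _ =>
    (Rand.costLE_lift (c := d * (n + 1)) ?_).bind fun _ =>
    (Rand.costLE_lift (cost_radius _).le).bind fun _ =>
    (costLE_compressKV K V _ β r).bind fun _ =>
    Rand.costLE_lift (cost_wtdAttn _ _ _ _ _ _ _)) ?_
  iterate 2 simp [cost_vec, cost_minOver, cost_maxOver, cost_pure]
  -- Constant costs, such as that of the temperature, are absorbed by the factor `m + n` only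
  -- because `n ≥ 1`.
  obtain ⟨n, rfl⟩ := Nat.exists_eq_add_of_le' hn
  ring_nf
  omega

end Cost

end Algorithm

/-! ## Norms -/

section Norms

variable {m n d : ℕ}

theorem rowNorm_nonneg (A : Matrix (Fin m) (Fin d) ℝ) : 0 ≤ rowNorm A :=
  Real.iSup_nonneg fun _ => Real.sqrt_nonneg _

theorem sum_sq_le_rowNorm_sq (A : Matrix (Fin m) (Fin d) ℝ) (i : Fin m) :
    ∑ j, A i j ^ 2 ≤ rowNorm A ^ 2 := by
  have h : Real.sqrt (∑ j, A i j ^ 2) ≤ rowNorm A :=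
    le_ciSup (f := fun i => Real.sqrt (∑ j, A i j ^ 2)) (Finite.bddAbove_range _) i
  rwa [Real.sqrt_le_left (rowNorm_nonneg A)] at h

theorem abs_dot_le_rowNorm (A : Matrix (Fin m) (Fin d) ℝ) (B : Matrix (Fin n) (Fin d) ℝ)
    (i : Fin m) (l : Fin n) : |∑ c, A i c * B l c| ≤ rowNorm A * rowNorm B := by
  refine abs_le_of_sq_le_sq ?_ (mul_nonneg (rowNorm_nonneg A) (rowNorm_nonneg B))
  rw [mul_pow]
  exact (Finset.sum_mul_sq_le_sq_mul_sq _ _ _).trans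
    (mul_le_mul (sum_sq_le_rowNorm_sq A i) (sum_sq_le_rowNorm_sq B l)
      (Finset.sum_nonneg fun _ _ => sq_nonneg _) (sq_nonneg _))

theorem maxNorm_nonneg (A : Matrix (Fin m) (Fin n) ℝ) : 0 ≤ maxNorm A :=
  Real.iSup_nonneg fun _ => Real.iSup_nonneg fun _ => abs_nonneg _

theorem abs_le_maxNorm (A : Matrix (Fin m) (Fin n) ℝ) (i : Fin m) (j : Fin n) :
    |A i j| ≤ maxNorm A :=
  (le_ciSup (f := fun j => |A i j|) (Finite.bddAbove_range _) j).trans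
    (le_ciSup (f := fun i => ⨆ j, |A i j|) (Finite.bddAbove_range _) i)

theorem maxNorm_le {A : Matrix (Fin m) (Fin n) ℝ} {c : ℝ} (hc : 0 ≤ c)
    (h : ∀ i j, |A i j| ≤ c) : maxNorm A ≤ c :=
  Real.iSup_le (fun i => Real.iSup_le (fun j => h i j) hc) hc

end Norms

/-! ## Stability of normalized and clipped averages -/

/-- Projection onto an interval does not increase the distance to a point of that interval. -/
theorem abs_clip_sub_le {lo hi x y : ℝ} (h1 : lo ≤ y) (h2 : y ≤ hi) :
    |y - max lo (min x hi)| ≤ |y - x| := by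
  rcases le_total x hi with h3 | h3 <;> rcases le_total lo x with h4 | h4 <;>
  simp only [abs_le, le_abs] <;> grind

-- The approximate weights `b` need not be positive. If their total error is at most half of `D`,
-- the denominator stays above `D / 2` and a perturbation estimate applies; otherwise clipping alone
-- gives error `2u`, which the right side already exceeds. The common factor `e` stands for the
-- contribution of the mean key.
open Classical in
theorem abs_average_sub_clip_le {n : ℕ} (hn : 1 ≤ n) {a b v : Fin n → ℝ} {u e D₀ ε : ℝ}
    (he : 0 < e) (hD₀ : 0 < D₀) (ha : ∀ l, D₀ ≤ a l) (hv : ∀ l, |v l| ≤ u)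
    (hab : ∀ l, |a l - b l| ≤ ε) :
    |(∑ l, a l * v l) / ∑ l, a l - max (⨅ l, v l)
      (min (if 0 < e * ∑ l, b l then (e * ∑ l, b l * v l) / (e * ∑ l, b l) else 0) (⨆ l, v l))|
      ≤ u * (4 * D₀⁻¹ * ε) := by
  have : Nonempty (Fin n) := ⟨⟨0, hn⟩⟩
  have hn' : (0 : ℝ) < n := by exact_mod_cast hn
  have hu : 0 ≤ u := (abs_nonneg _).trans (hv ⟨0, hn⟩)
  have hε : 0 ≤ ε := (abs_nonneg _).trans (hab ⟨0, hn⟩)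
  set D := ∑ l, a l with hD
  have hDn : n * D₀ ≤ D := by
    have := Finset.sum_le_sum fun l (_ : l ∈ Finset.univ) => ha l
    simpa using this
  have hDpos : 0 < D := by
    have : 0 < n * D₀ := by positivity
    linarith
  set O := (∑ l, a l * v l) / D with hO
  have hlo : (⨅ l, v l) ≤ O := by
    rw [hO, le_div_iff₀ hDpos, hD, Finset.mul_sum]
    refine Finset.sum_le_sum fun l _ => ?_
    rw [mul_comm]
    exact mul_le_mul_of_nonneg_left (ciInf_le (Finite.bddBelow_range _) l) (hD₀.le.trans (ha l))
  have hhi : O ≤ ⨆ l, v l := by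
    rw [hO, div_le_iff₀ hDpos, hD, Finset.mul_sum]
    refine Finset.sum_le_sum fun l _ => ?_
    rw [mul_comm]
    exact mul_le_mul_of_nonneg_right (le_ciSup (Finite.bddAbove_range _) l) (hD₀.le.trans (ha l))
  have hlo' : -u ≤ ⨅ l, v l := le_ciInf fun l => (abs_le.1 (hv l)).1
  have hhi' : (⨆ l, v l) ≤ u := ciSup_le fun l => (abs_le.1 (hv l)).2
  have hOu : |O| ≤ u := abs_le.2 ⟨hlo'.trans hlo, hhi.trans hhi'⟩
  have hmain : ∀ {c : ℝ}, c ≤ 4 * (n * ε) * u / D → c ≤ u * (4 * D₀⁻¹ * ε) := by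
    intro c hc
    refine hc.trans ?_
    rw [div_le_iff₀ hDpos]
    calc 4 * (n * ε) * u = u * (4 * D₀⁻¹ * ε) * (n * D₀) := by field_simp
      _ ≤ _ := mul_le_mul_of_nonneg_left hDn (by positivity)
  apply hmain
  have hsub : |D - ∑ l, b l| ≤ n * ε := by
    rw [hD, ← Finset.sum_sub_distrib]
    refine (Finset.abs_sum_le_sum_abs _ _).trans ?_
    have := Finset.sum_le_sum fun l (_ : l ∈ Finset.univ) => hab l
    simpa using this
  by_cases hcase : n * ε ≤ D / 2
  · have hb : D / 2 ≤ ∑ l, b l := by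
      have := (abs_le.1 hsub).2
      linarith
    have hbpos : 0 < ∑ l, b l := by linarith
    rw [if_pos (by positivity), mul_div_mul_left _ _ he.ne']
    refine (abs_clip_sub_le hlo hhi).trans ?_
    -- Centring the values at `O` costs nothing, since `∑ a l (v l - O) = 0`; it leaves only the
    -- weight errors `a - b`.
    have e1 : O - (∑ l, b l * v l) / ∑ l, b l = (∑ l, (a l - b l) * (v l - O)) / ∑ l, b l := by
      have e2 : ∑ l, (a l - b l) * (v l - O) = (∑ l, a l * v l) - O * D
          - ∑ l, b l * v l + O * ∑ l, b l := by
        rw [hD, Finset.mul_sum, Finset.mul_sum, ← Finset.sum_sub_distrib, ← Finset.sum_sub_distrib,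
          ← Finset.sum_add_distrib]
        exact Finset.sum_congr rfl fun l _ => by ring
      have e3 : O * D = ∑ l, a l * v l := by rw [hO]; field_simp
      rw [e2, e3]
      field_simp
      ring
    rw [e1, abs_div, abs_of_pos hbpos]
    have e4 : |∑ l, (a l - b l) * (v l - O)| ≤ n * ε * (2 * u) := by
      refine (Finset.abs_sum_le_sum_abs _ _).trans ?_
      have : ∀ l ∈ Finset.univ, |(a l - b l) * (v l - O)| ≤ ε * (2 * u) := by
        intro l _
        rw [abs_mul]
        refine mul_le_mul (hab l) ?_ (abs_nonneg _) hε
        refine (abs_sub _ _).trans ?_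
        linarith [hv l]
      refine (Finset.sum_le_sum this).trans (le_of_eq ?_)
      simp; ring
    calc _ ≤ n * ε * (2 * u) / (D / 2) := div_le_div₀ (by positivity) e4 (by positivity) hb
      _ = _ := by field_simp; ring
  · push Not at hcase
    set x := max (⨅ l, v l)
      (min (if 0 < e * ∑ l, b l then (e * ∑ l, b l * v l) / (e * ∑ l, b l) else 0) (⨆ l, v l))
    have hx1 : -u ≤ x := hlo'.trans (le_max_left _ _)
    have hx2 : x ≤ u := max_le ((hlo.trans hhi).trans hhi') ((min_le_right _ _).trans hhi')
    have : |O - x| ≤ 2 * u := by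
      refine (abs_sub _ _).trans ?_
      have := abs_le.2 ⟨hx1, hx2⟩
      linarith
    refine this.trans ?_
    rw [le_div_iff₀ hDpos]
    nlinarith

/-! ## The temperature -/

theorem kernel_val {d : ℕ} (β τ : ℝ) (x y : Fin d → ℝ) :
    (kernel β τ x y).val = expKernel (β / (τ * τ)) x y := by
  change Real.exp (β * (∑ i, x i * y i) / (τ * τ)) = _
  rw [expKernel, div_mul_eq_mul_div]

/-- A positive lower bound for the values of the Lambert function in the temperature. -/
def lambertFloor : ℝ := min 1 (1 / rhoZero / Real.exp 1)

theorem lambertFloor_pos : 0 < lambertFloor := by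
  have := one_le_rhoZero
  unfold lambertFloor
  positivity

section Temperature

variable {β RQ RK : ℝ} {n : ℕ}

theorem getTemperature_val (β RQ RK : ℝ) (n : ℕ) : (getTemperature β RQ RK n).val =
    Real.sqrt (RK / RQ * ((Real.log n / (β * RQ * RK) + 2) /
      (2 * lambertW ((Real.log n / (β * RQ * RK) + 2) / (2 * rhoZero))))) := rfl

theorem getTemperature_eq_zero (h : RQ = 0 ∨ RK = 0) : (getTemperature β RQ RK n).val = 0 := by
  rw [getTemperature_val]
  rcases h with h | h <;> simp [h]

/-- The square of the temperature for nonzero radii. -/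
theorem getTemperature_sq (hβ : 0 < β) (hQ : 0 < RQ) (hK : 0 < RK) :
    ∃ w : ℝ, lambertFloor ≤ w ∧ 2 * w ≤ Real.log n / (β * RQ * RK) + 2 ∧
      0 < (getTemperature β RQ RK n).val ∧
      (getTemperature β RQ RK n).val * (getTemperature β RQ RK n).val =
        RK / RQ * ((Real.log n / (β * RQ * RK) + 2) / (2 * w)) := by
  set b := Real.log n / (β * RQ * RK) + 2 with hb
  have hb2 : 2 ≤ b := by
    have : 0 ≤ Real.log n / (β * RQ * RK) := div_nonneg (Real.log_natCast_nonneg n) (by positivity)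
    linarith
  have hρ := one_le_rhoZero
  have hρ0 : 0 < rhoZero := by linarith
  have hz : 1 / rhoZero ≤ b / (2 * rhoZero) := by
    rw [div_le_div_iff₀ hρ0 (by positivity)]
    nlinarith
  have hz0 : 0 < 1 / rhoZero := by positivity
  have hw := min_le_lambertW hz0 hz
  have hspec := (lambertW_spec (hz0.trans_le hz)).2
  have hfloor := lambertFloor_pos
  set w := lambertW (b / (2 * rhoZero)) with hwd
  have hw' : lambertFloor ≤ w := hw
  have hwpos : 0 < w := by linarith
  have hnn : 0 < RK / RQ * (b / (2 * w)) := by positivity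
  refine ⟨w, hw', ?_, ?_, ?_⟩
  · have h1 : 1 ≤ Real.exp w := Real.one_le_exp hwpos.le
    -- With `rhoZero ≥ 1` and `exp w ≥ 1` the Lambert equation yields `2w ≤ b`, which keeps the
    -- kernel exponents at the keys below `β R_Q R_K`.
    have h2 : 2 * rhoZero * (w * Real.exp w) = b := by rw [hspec]; field_simp
    have h3 : w ≤ w * Real.exp w := le_mul_of_one_le_right hwpos.le h1
    nlinarith
  · rw [getTemperature_val]
    exact Real.sqrt_pos.2 hnn
  · rw [getTemperature_val]
    exact Real.mul_self_sqrt hnn.le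

/-- The exponents of the kernel at the recentred keys. -/
theorem div_getTemperature_sq_mul_le (hβ : 0 < β) (hQ : 0 ≤ RQ) (hK : 0 ≤ RK) :
    β / ((getTemperature β RQ RK n).val * (getTemperature β RQ RK n).val) * RK ^ 2 ≤
      β * RQ * RK := by
  by_cases h : RQ = 0 ∨ RK = 0
  · rw [getTemperature_eq_zero h]
    simp only [mul_zero, div_zero, zero_mul]
    positivity
  · push Not at h
    have hQ' : 0 < RQ := lt_of_le_of_ne hQ h.1.symm
    have hK' : 0 < RK := lt_of_le_of_ne hK h.2.symm
    obtain ⟨w, hw, hwb, -, hsq⟩ := getTemperature_sq (n := n) hβ hQ' hK'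
    have hwpos := lambertFloor_pos.trans_le hw
    rw [hsq]
    set b := Real.log n / (β * RQ * RK) + 2
    have hbpos : 0 < b := by linarith
    have : β / (RK / RQ * (b / (2 * w))) * RK ^ 2 = β * RQ * RK * ((2 * w) / b) := by
      field_simp
    rw [this]
    refine mul_le_of_le_one_right (by positivity) ?_
    rwa [div_le_one hbpos]

/-- The exponents of the kernel at the rescaled queries. -/
theorem getTemperature_sq_mul_le (hβ : 0 < β) (hQ : 0 ≤ RQ) (hK : 0 ≤ RK) :
    β * ((getTemperature β RQ RK n).val * (getTemperature β RQ RK n).val) * RQ ^ 2 ≤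
      (Real.log n + 2 * (β * RQ * RK)) / (2 * lambertFloor) := by
  have hl := Real.log_natCast_nonneg n
  have hf := lambertFloor_pos
  by_cases h : RQ = 0 ∨ RK = 0
  · rw [getTemperature_eq_zero h]
    simp only [mul_zero, zero_mul]
    positivity
  · push Not at h
    have hQ' : 0 < RQ := lt_of_le_of_ne hQ h.1.symm
    have hK' : 0 < RK := lt_of_le_of_ne hK h.2.symm
    obtain ⟨w, hw, hwb, -, hsq⟩ := getTemperature_sq (n := n) hβ hQ' hK'
    have hwpos := lambertFloor_pos.trans_le hw
    rw [hsq]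
    have : β * (RK / RQ * ((Real.log n / (β * RQ * RK) + 2) / (2 * w))) * RQ ^ 2 =
        (Real.log n + 2 * (β * RQ * RK)) / (2 * w) := by
      field_simp
    rw [this]
    gcongr

end Temperature

/-! ## The error of WildCat for a given final state -/

section Error

variable {m n d r : ℕ} {Q : Matrix (Fin m) (Fin d) ℝ} {K : Matrix (Fin n) (Fin d) ℝ} {β : ℝ}

theorem isPSDKernel_kernel (hβ : 0 ≤ β) (τ : ℝ) :
    IsPSDKernel fun x y : Fin d → ℝ => (kernel β τ x y).val := by
  simp only [kernel_val]
  exact isPSDKernel_expKernel (div_nonneg hβ (mul_self_nonneg τ))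

theorem kernel_symm (β τ : ℝ) (x y : Fin d → ℝ) :
    (kernel β τ x y).val = (kernel β τ y x).val := by
  simp only [kernel_val, expKernel, mul_comm]

/-- The query, rescaled so that the kernel reproduces the attention weights. -/
theorem kernel_rescaled_query (hβ : 0 < β) (i : Fin m) (l : Fin n) :
    (kernel β (temperature β Q K)
      (fun c => temperature β Q K * temperature β Q K * Q i c) (recentred K l)).val =
      Real.exp (β * ∑ c, Q i c * recentred K l c) := by
  rw [kernel_val, expKernel]
  congr 1
  simp only [mul_assoc, ← Finset.mul_sum]
  -- If a radius vanishes, then `τ = 0` and the kernel is constantly `1`; this is still right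
  -- because all inner products of queries with recentred keys are zero.
  by_cases h : rowNorm Q = 0 ∨ rowNorm (recentred K) = 0
  · have h0 := abs_dot_le_rowNorm Q (recentred K) i l
    have h1 : rowNorm Q * rowNorm (recentred K) = 0 := by rcases h with h | h <;> simp [h]
    rw [h1] at h0
    have h2 : ∑ c, Q i c * recentred K l c = 0 := abs_eq_zero.1 (le_antisymm h0 (abs_nonneg _))
    rw [h2]; ring
  · push Not at h
    obtain ⟨w, -, -, hpos, -⟩ := getTemperature_sq (n := n) hβ
      (lt_of_le_of_ne (rowNorm_nonneg Q) h.1.symm)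
      (lt_of_le_of_ne (rowNorm_nonneg (recentred K)) h.2.symm)
    have hτ : temperature β Q K ≠ 0 := hpos.ne'
    field_simp

theorem kernel_rescaled_query_self_le (hβ : 0 < β) (i : Fin m) :
    (kernel β (temperature β Q K)
      (fun c => temperature β Q K * temperature β Q K * Q i c)
      (fun c => temperature β Q K * temperature β Q K * Q i c)).val ≤
      Real.exp ((Real.log n + 2 * (β * rowNorm Q * rowNorm (recentred K))) /
        (2 * lambertFloor)) := by
  rw [kernel_val, expKernel]
  refine Real.exp_le_exp.2 (le_trans ?_ (getTemperature_sq_mul_le hβ (rowNorm_nonneg Q)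
    (rowNorm_nonneg (recentred K))))
  change _ ≤ β * (temperature β Q K * temperature β Q K) * rowNorm Q ^ 2
  set τ := temperature β Q K
  have h1 : ∑ c, τ * τ * Q i c * (τ * τ * Q i c) = τ ^ 4 * ∑ c, Q i c ^ 2 := by
    rw [Finset.mul_sum]; exact Finset.sum_congr rfl fun c _ => by ring
  rw [h1]
  have h2 : β / (τ * τ) * (τ ^ 4 * ∑ c, Q i c ^ 2) = β * (τ * τ) * ∑ c, Q i c ^ 2 := by
    by_cases hτ : τ = 0
    · rw [hτ]; ring
    · field_simp
  rw [h2]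
  exact mul_le_mul_of_nonneg_left (sum_sq_le_rowNorm_sq Q i)
    (mul_nonneg hβ.le (mul_self_nonneg τ))

/-- The weight errors are residuals between the rescaled query `x` and the keys, so Cauchy–Schwarz
bounds them by `√(residual x x · ∑ p)`. Domination by the kernel controls the first factor, although
`x` is not a key. -/
theorem maxNorm_attention_sub_outputOf_le (hn : 1 ≤ n) (hβ : 0 < β) (V : Matrix (Fin n) (Fin d) ℝ)
    {st : NysState n r}
    (hst : NysInvariant (recentred K) (kernel β (temperature β Q K)) st) :
    maxNorm (attention β Q K V - outputOf Q K V β st) ≤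
      maxNorm V * (4 * (Real.exp (-(β * rowNorm Q * rowNorm (recentred K))))⁻¹ *
        Real.sqrt (Real.exp ((Real.log n + 2 * (β * rowNorm Q * rowNorm (recentred K))) /
        (2 * lambertFloor)) * ∑ l, st.p l)) := by
  classical
  set τ := temperature β Q K with hτ
  set h := kernel (d := d) β τ with hh
  set Kc := recentred K with hKc
  refine maxNorm_le (by have := maxNorm_nonneg V; positivity) fun i j => ?_
  set x : Fin d → ℝ := fun c => τ * τ * Q i c with hx
  set e := Real.exp (β * ∑ c, Q i c * keyMean K c) with he
  set a : Fin n → ℝ := fun l => Real.exp (β * ∑ c, Q i c * Kc l c) with ha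
  set b : Fin n → ℝ := fun l => ∑ s, slotFeature Kc h st.S s x * nysWeights st s l with hb
  have hah : ∀ l, a l = (h x (Kc l)).val := fun l => (kernel_rescaled_query hβ i l).symm
  have hatt : attention β Q K V i j = (∑ l, a l * V l j) / ∑ l, a l := by
    have h1 : ∀ l, Real.exp (β * ∑ c, Q i c * K l c) = e * a l := by
      intro l
      rw [he, ha, ← Real.exp_add, ← mul_add, ← Finset.sum_add_distrib]
      congr 2
      refine Finset.sum_congr rfl fun c _ => ?_
      rw [hKc, recentred, keyMean]; ring
    simp only [attention, h1, mul_assoc]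
    rw [← Finset.mul_sum, ← Finset.mul_sum, mul_div_mul_left _ _ (Real.exp_pos _).ne']
  have hA : ∀ s l, Real.exp (β * ∑ c, Q i c * coresetKeys K st s c) * nysWeights st s l =
      e * (slotFeature Kc h st.S s x * nysWeights st s l) := by
    intro s l
    -- The key of an empty slot is the mean, with a nonzero exponential; only its zero Nyström
    -- weight removes it.
    cases hs : st.S s with
    | none =>
      have : nysWeights st s l = 0 :=
        Finset.sum_eq_zero fun k _ => by rw [hst.left_zero _ _ hs, zero_mul]
      rw [this]; ring
    | some s' =>
      have h1 : slotFeature Kc h st.S s x = a s' := by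
        simp only [slotFeature, hs]
        rw [hah, hh, kernel_symm]
      rw [h1, ← mul_assoc, he, ha, ← Real.exp_add, ← mul_add, ← Finset.sum_add_distrib]
      congr 3
      refine Finset.sum_congr rfl fun c _ => ?_
      simp only [coresetKeys, hs]; ring
  have hDb : ∑ s, Real.exp (β * ∑ c, Q i c * coresetKeys K st s c) * ∑ l, nysWeights st s l =
      e * ∑ l, b l := by
    rw [Finset.sum_congr rfl fun s _ => (Finset.mul_sum _ _ _).trans
      (Finset.sum_congr rfl fun l _ => hA s l), Finset.sum_comm, Finset.mul_sum]
    exact Finset.sum_congr rfl fun l _ => (Finset.mul_sum _ _ _).symm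
  have hNb : ∑ s, Real.exp (β * ∑ c, Q i c * coresetKeys K st s c) *
      ∑ l, nysWeights st s l * V l j = e * ∑ l, b l * V l j := by
    rw [Finset.sum_congr rfl fun s _ => (Finset.mul_sum _ _ _).trans
      (Finset.sum_congr rfl fun l _ => by rw [← mul_assoc, hA s l]), Finset.sum_comm,
      Finset.mul_sum]
    refine Finset.sum_congr rfl fun l _ => ?_
    rw [← Finset.sum_mul, ← Finset.mul_sum, mul_assoc]
  have hres : ∀ l, a l - b l = residual Kc h st x (Kc l) := by
    intro l
    rw [hah, hb, residual]
    congr 1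
    refine Finset.sum_congr rfl fun s _ => ?_
    rw [nysWeights, Finset.mul_sum]
    exact Finset.sum_congr rfl fun k _ => by rw [hst.row]; ring
  have hxx : residual Kc h st x x ≤ Real.exp ((Real.log n + 2 * (β * rowNorm Q * rowNorm Kc)) /
        (2 * lambertFloor)) := by
    have := hst.dominated 1 (fun _ => x) (fun _ => 1)
    simp only [Finset.univ_unique, Finset.sum_singleton, one_mul] at this
    exact this.trans (kernel_rescaled_query_self_le hβ i)
  rw [Matrix.sub_apply, hatt]
  simp only [outputOf, hDb, hNb]
  refine abs_average_sub_clip_le hn (Real.exp_pos _) (Real.exp_pos _) (fun l => ?_)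
    (fun l => abs_le_maxNorm V l j) fun l => ?_
  · refine Real.exp_le_exp.2 ?_
    have := (abs_le.1 (abs_dot_le_rowNorm Q Kc i l)).1
    nlinarith
  · rw [hres]
    refine Real.abs_le_sqrt ((hst.psd.sq_le x (Kc l)).trans ?_)
    rw [← hst.diag]
    exact mul_le_mul hxx (Finset.single_le_sum (fun l _ => hst.p_nonneg l) (Finset.mem_univ l))
      (hst.p_nonneg l) (Real.exp_pos _).le

/-! ## The expected error -/

theorem nysInvariant_nysInit {h : (Fin d → ℝ) → (Fin d → ℝ) → Timed ℝ}
    (hpsd : IsPSDKernel fun x y => (h x y).val) (K : Matrix (Fin n) (Fin d) ℝ) (r : ℕ) :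
    NysInvariant K h (nysInit K h r) := by
  have hres : residual K h (nysInit K h r) = fun x y => (h x y).val := by
    funext x y
    simp [residual, nysInit]
  refine ⟨by rwa [hres], ?_, ?_, ?_, ?_, ?_⟩
  · intro j l; simp [nysInit, slotFeature]
  · intro j k _; rfl
  · intro j k _; rfl
  · intro l; rw [hres]; rfl
  · intro N z v; rw [hres]

theorem expKernel_recentred_exponent_le (hβ : 0 < β) (l l' : Fin n) :
    |β / (temperature β Q K * temperature β Q K) * ∑ c, recentred K l c * recentred K l' c| ≤
      β * rowNorm Q * rowNorm (recentred K) := by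
  have h0 : 0 ≤ β / (temperature β Q K * temperature β Q K) :=
    div_nonneg hβ.le (mul_self_nonneg _)
  rw [abs_mul, abs_of_nonneg h0]
  refine le_trans (mul_le_mul_of_nonneg_left (abs_dot_le_rowNorm _ _ l l') h0) ?_
  rw [← sq (rowNorm (recentred K))]
  exact div_getTemperature_sq_mul_le hβ (rowNorm_nonneg Q) (rowNorm_nonneg _)

/-- The expected error in terms of the number of rounds and of a low-rank approximation
(of rank `k`, with trace error `η`) of the matrices dominated by the kernel matrix. -/
theorem expectedError_le (hn : 1 ≤ n) (hβ : 0 < β) (V : Matrix (Fin n) (Fin d) ℝ) {G : ℝ}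
    (hG : β * rowNorm Q * rowNorm (recentred K) ≤ G) {k η : ℝ} (hk : 1 ≤ k) (hη : 0 ≤ η)
    (htrace : ∀ st : NysState n r, NysInvariant (recentred K) (kernel β (temperature β Q K)) st →
      ∑ l, st.p l ≤ η + Real.sqrt (k * ∑ l, ∑ l', residual (recentred K)
        (kernel β (temperature β Q K)) st (recentred K l) (recentred K l') ^ 2))
    {δ : ℝ} (hδ : 0 < δ)
    (hT : (1 - 1 / (4 * k)) ^ r * (n * Real.exp G) + 2 * η ≤
      δ ^ 2 * (Real.exp (2 * G + (Real.log n + 2 * G) / (2 * lambertFloor)))⁻¹ / 2) :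
    expectedError Q K V β r ≤ ENNReal.ofReal (3 * maxNorm V * δ) := by
  set γ := β * rowNorm Q * rowNorm (recentred K) with hγ
  have hγ0 : 0 ≤ γ := mul_nonneg (mul_nonneg hβ.le (rowNorm_nonneg _)) (rowNorm_nonneg _)
  have hV := maxNorm_nonneg V
  have hf := lambertFloor_pos
  set P := Real.exp (2 * G + (Real.log n + 2 * G) / (2 * lambertFloor)) with hP
  have hPpos : 0 < P := Real.exp_pos _
  set h := kernel (d := d) β (temperature β Q K) with hh
  have hinit := nysInvariant_nysInit (isPSDKernel_kernel hβ.le (temperature β Q K))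
    (recentred K) r
  have hpoint : ∀ st : NysState n r, NysInvariant (recentred K) h st →
      ENNReal.ofReal (maxNorm (attention β Q K V - outputOf Q K V β st)) ≤
        ENNReal.ofReal (maxNorm V * δ + (maxNorm V * (4 * P / δ)) * ∑ l, st.p l) := by
    intro st hst
    refine ENNReal.ofReal_le_ofReal ((maxNorm_attention_sub_outputOf_le hn hβ V hst).trans ?_)
    rw [mul_assoc (maxNorm V) (4 * P / δ), ← mul_add]
    refine mul_le_mul_of_nonneg_left ?_ hV
    set T := ∑ l, st.p l
    have hT0 : 0 ≤ T := Finset.sum_nonneg fun l _ => hst.p_nonneg l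
    have h1 : (Real.exp (-γ))⁻¹ * Real.sqrt (Real.exp ((Real.log n + 2 * γ) /
        (2 * lambertFloor)) * T) ≤ Real.sqrt (P * T) := by
      refine Real.le_sqrt_of_sq_le ?_
      rw [mul_pow, Real.sq_sqrt (by positivity), ← Real.exp_neg, neg_neg, ← mul_assoc,
        ← Real.exp_nat_mul, ← Real.exp_add]
      refine mul_le_mul_of_nonneg_right (Real.exp_le_exp.2 ?_) hT0
      push_cast
      gcongr
    -- By the AM–GM inequality the square root is replaced by an affine function of `T`, the form
    -- that the rounds propagate; no Jensen inequality is needed. After multiplication by `4` the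
    -- constant part is `δ`, and the part linear in `T` will contribute `2δ`, whence the factor `3`.
    have h2 : Real.sqrt (P * T) ≤ δ / 4 + P / δ * T := by
      refine Real.sqrt_le_iff.2 ⟨by positivity, ?_⟩
      have h3 : P * T = δ * (P / δ * T) := by field_simp
      nlinarith [sq_nonneg (δ / 4 - P / δ * T)]
    calc _ = 4 * ((Real.exp (-γ))⁻¹ * Real.sqrt (Real.exp ((Real.log n + 2 * γ) /
        (2 * lambertFloor)) * T)) := by ring
      _ ≤ 4 * (δ / 4 + P / δ * T) := by linarith
      _ = _ := by ring
  rw [expectedError_eq]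
  refine (eexpect_foldlM_nysStep_le (kernel_symm β _) hk hη htrace
    (A := maxNorm V * δ) (B := maxNorm V * (4 * P / δ)) (by positivity) (by positivity) hpoint
    (List.finRange r) (List.nodup_finRange r) hinit fun i _ => rfl).trans ?_
  refine ENNReal.ofReal_le_ofReal ?_
  rw [List.length_finRange]
  have hk' : 1 / (4 * k) ≤ 1 := by rw [div_le_one (by linarith)]; linarith
  have hq : 0 ≤ (1 - 1 / (4 * k)) ^ r := pow_nonneg (by linarith) r
  have hT0 : ∑ l, (nysInit (recentred K) h r).p l ≤ n * Real.exp G := by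
    have : ∀ l ∈ Finset.univ, (nysInit (recentred K) h r).p l ≤ Real.exp G := by
      intro l _
      change (h _ _).val ≤ _
      rw [hh, kernel_val, expKernel]
      refine Real.exp_le_exp.2 ?_
      exact (le_abs_self _).trans ((expKernel_recentred_exponent_le hβ l l).trans hG)
    refine (Finset.sum_le_sum this).trans (by simp)
  have h4 : (1 - 1 / (4 * k)) ^ r * ∑ l, (nysInit (recentred K) h r).p l +
      (1 - (1 - 1 / (4 * k)) ^ r) * (2 * η) ≤ δ ^ 2 * P⁻¹ / 2 := by
    refine le_trans ?_ hT
    have h5 := mul_le_mul_of_nonneg_left hT0 hq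
    nlinarith [mul_nonneg hq hη]
  calc _ ≤ maxNorm V * δ + maxNorm V * (4 * P / δ) * (δ ^ 2 * P⁻¹ / 2) := by
        have := mul_le_mul_of_nonneg_left h4 (show 0 ≤ maxNorm V * (4 * P / δ) by positivity)
        linarith
    _ = _ := by field_simp; ring

theorem trace_le_of_monomials (hβ : 0 < β) {G : ℝ}
    (hG : β * rowNorm Q * rowNorm (recentred K) ≤ G) {N : ℕ} (hN : 2 * G ≤ N + 1)
    {st : NysState n r} (hst : NysInvariant (recentred K) (kernel β (temperature β Q K)) st) :
    ∑ l, st.p l ≤ n ^ 2 * (G ^ N / N.factorial * 2) + Real.sqrt ((N * 2 ^ (d + N) : ℕ) *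
      ∑ l, ∑ l', residual (recentred K) (kernel β (temperature β Q K)) st (recentred K l)
        (recentred K l') ^ 2) := by
  set c := β / (temperature β Q K * temperature β Q K) with hc
  have h1 := trace_le_of_low_rank (n := n) (ι := MonomialIndex d N)
    (fun l l' => residual (recentred K) (kernel β (temperature β Q K)) st (recentred K l)
      (recentred K l'))
    (fun l l' => (kernel β (temperature β Q K) (recentred K l) (recentred K l')).val)
    (fun f l => monomialWeight c f * monomialFeature f (recentred K l))
    (fun f l => monomialFeature f (recentred K l))
    (ε := G ^ N / N.factorial * 2) (fun v => hst.dominated n _ v) ?_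
  · simp only [hst.diag]
    refine h1.trans ?_
    gcongr
    exact card_monomialIndex_le d N
  · intro l l'
    rw [kernel_val, expKernel]
    simp only [mul_assoc, ← hc]
    rw [← sum_range_eq_sum_monomial]
    exact abs_exp_sub_taylor_le ((expKernel_recentred_exponent_le hβ l l').trans hG) hN

/-- The kernel matrix is its own approximation of rank `n`, with identity left factor and `ε = 0`.
-/
theorem trace_le_of_card {h : (Fin d → ℝ) → (Fin d → ℝ) → Timed ℝ} {K : Matrix (Fin n) (Fin d) ℝ}
    {st : NysState n r} (hst : NysInvariant K h st) :
    ∑ l, st.p l ≤ 0 + Real.sqrt (n * ∑ l, ∑ l', residual K h st (K l) (K l') ^ 2) := by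
  have h1 := trace_le_of_low_rank (n := n) (ι := Fin n)
    (fun l l' => residual K h st (K l) (K l')) (fun l l' => (h (K l) (K l')).val)
    (fun f l => if f = l then 1 else 0) (fun f l => (h (K f) (K l)).val)
    (ε := 0) (fun v => hst.dominated n _ v) (by intro i j; simp)
  simp only [hst.diag]
  simpa using h1

end Error

/-! ## Ranks that attain a given error -/

/-- The rank `r` attains the expected error `3 ‖V‖ δ` on all inputs with `n` keys of dimension `d`
and `β R_Q R_K ≤ G`. -/
def RankAttains (n d : ℕ) (G δ : ℝ) (r : ℕ) : Prop :=
  ∀ (m : ℕ) (β : ℝ) (Q : Matrix (Fin m) (Fin d) ℝ) (K V : Matrix (Fin n) (Fin d) ℝ), 0 < β →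
    β * rowNorm Q * rowNorm (recentred K) ≤ G →
      expectedError Q K V β r ≤ ENNReal.ofReal (3 * maxNorm V * δ)

/-- For fixed `n` the exact approximation of rank `n` has `η = 0`, so the expected trace bound
decays to zero in the number of rounds. This covers the small `n`, where no asymptotic estimate
applies. -/
theorem exists_rankAttains {n : ℕ} (hn : 1 ≤ n) (d : ℕ) (G : ℝ) {δ : ℝ} (hδ : 0 < δ) :
    ∃ r, RankAttains n d G δ r := by
  have hn' : (1 : ℝ) ≤ n := by exact_mod_cast hn
  set c := δ ^ 2 * (Real.exp (2 * G + (Real.log n + 2 * G) / (2 * lambertFloor)))⁻¹ / 2 with hc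
  have hcpos : 0 < c := by positivity
  have hq : 1 - 1 / (4 * (n : ℝ)) < 1 := by
    have : 0 < 1 / (4 * (n : ℝ)) := by positivity
    linarith
  obtain ⟨r, hr⟩ := exists_pow_lt_of_lt_one
    (show 0 < c / (n * Real.exp G) by positivity) hq
  rw [lt_div_iff₀ (by positivity)] at hr
  exact ⟨r, fun m β Q K V hβ hG => expectedError_le hn hβ V hG hn' le_rfl
    (fun st hst => trace_le_of_card hst) hδ (by linarith)⟩

/-- This is `N^N / N! ≤ e^N`, one term of the exponential series at `N`. -/
theorem pow_div_factorial_le_pow {G : ℝ} (hG : 0 ≤ G) {N : ℕ} (hN : 1 ≤ N) :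
    G ^ N / N.factorial ≤ (G * Real.exp 1 / N) ^ N := by
  have h := Real.pow_div_factorial_le_exp (N : ℝ) (Nat.cast_nonneg N) N
  have hN' : (0 : ℝ) < N := by exact_mod_cast hN
  have e1 : (G * Real.exp 1 / N) ^ N = G ^ N * (Real.exp N / (N : ℝ) ^ N) := by
    rw [div_pow, mul_pow, ← Real.exp_nat_mul, mul_one, mul_div_assoc]
  rw [e1, div_eq_mul_inv]
  refine mul_le_mul_of_nonneg_left ?_ (by positivity)
  rw [le_div_iff₀ (by positivity), mul_comm, ← div_eq_mul_inv]
  exact h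

/-- The exponent of `n` that the residual trace has to beat in order to attain the error
`n ^ (-a)`. -/
def traceExponent (a : ℝ) : ℝ := 2 * |a| + 2 + 3 / (2 * lambertFloor)

theorem traceExponent_nonneg (a : ℝ) : 0 ≤ traceExponent a := by
  have := lambertFloor_pos
  unfold traceExponent
  positivity

/-- The number of rounds that suffices for monomials of degree less than `N`. -/
def rankFor (n d N : ℕ) (a : ℝ) : ℕ :=
  ⌈4 * ((N * 2 ^ (d + N) : ℕ) : ℝ) * ((traceExponent a + 2) * Real.log n + 2)⌉₊

/-- With `A = traceExponent a`, the target for the trace is at least `n^{-A} / 2`, and the rounds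
and the Taylor remainder get a quarter of `n^{-A}` each. -/
theorem rankAttains_rankFor {n : ℕ} (d : ℕ) {N : ℕ} (hN : 1 ≤ N) {G a κ : ℝ} (hL : 3 ≤ Real.log n)
    (hG0 : 0 ≤ G) (hGL : G ≤ Real.log n) (hκ : 0 ≤ κ)
    (hGN : G * Real.exp 1 / N ≤ Real.log n ^ (-κ))
    (hNL : (traceExponent a + 3) * Real.log n ≤ κ * N * Real.log (Real.log n)) :
    RankAttains n d G ((n : ℝ) ^ (-a)) (rankFor n d N a) := by
  set L := Real.log n with hLdef
  have hL0 : 0 < L := by linarith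
  have hn0 : n ≠ 0 := by rintro rfl; simp [hLdef] at hL; linarith
  have hn : 1 ≤ n := Nat.one_le_iff_ne_zero.2 hn0
  have hn' : (0 : ℝ) < n := by exact_mod_cast hn
  have hnL : (n : ℝ) = Real.exp L := (Real.exp_log hn').symm
  have hf := lambertFloor_pos
  have hA := traceExponent_nonneg a
  set A := traceExponent a with hAdef
  have hN' : (0 : ℝ) < N := by exact_mod_cast hN
  set k : ℕ := N * 2 ^ (d + N) with hk
  have hk1 : (1 : ℝ) ≤ (k : ℝ) := by
    exact_mod_cast Nat.one_le_iff_ne_zero.2 (by positivity)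
  set r := rankFor n d N a with hr
  have hrk : 4 * (k : ℝ) * ((A + 2) * L + 2) ≤ r := Nat.le_ceil _
  have h2G : 2 * G ≤ N + 1 := by
    have h1 : L ^ (-κ) ≤ 1 := Real.rpow_le_one_of_one_le_of_nonpos (by linarith) (by linarith)
    have h2 := hGN.trans h1
    rw [div_le_one hN'] at h2
    have h3 : 2 ≤ Real.exp 1 := by linarith [Real.add_one_le_exp (1 : ℝ)]
    nlinarith
  intro m β Q K V hβ hG
  refine expectedError_le hn hβ V hG hk1 (η := n ^ 2 * (G ^ N / N.factorial * 2))
    (by positivity) (fun st hst => trace_le_of_monomials hβ hG h2G hst)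
    (Real.rpow_pos_of_pos hn' _) ?_
  have hrhs : Real.exp (-(A * L)) / 2 ≤ ((n : ℝ) ^ (-a)) ^ 2 *
      (Real.exp (2 * G + (L + 2 * G) / (2 * lambertFloor)))⁻¹ / 2 := by
    rw [Real.rpow_def_of_pos hn', ← Real.exp_neg, ← Real.exp_nat_mul, ← Real.exp_add]
    refine div_le_div_of_nonneg_right (Real.exp_le_exp.2 ?_) two_pos.le
    have h1 : (L + 2 * G) / (2 * lambertFloor) ≤ 3 / (2 * lambertFloor) * L := by
      rw [div_mul_eq_mul_div]
      gcongr
      linarith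
    have h2 : a * L ≤ |a| * L := mul_le_mul_of_nonneg_right (le_abs_self a) hL0.le
    rw [hAdef, traceExponent, ← hLdef]
    push_cast
    linarith
  refine le_trans ?_ hrhs
  have e2 : Real.exp (-2) ≤ 1 / 4 := by
    rw [Real.exp_neg, ← one_div]
    refine one_div_le_one_div_of_le (by norm_num) ?_
    have := Real.add_one_le_exp (1 : ℝ)
    have h4 : Real.exp 2 = Real.exp 1 * Real.exp 1 := by rw [← Real.exp_add]; norm_num
    nlinarith
  -- The rounds give `exp(-((A+2)L + 2))`: the `2L` pays for the initial trace `n exp G ≤ exp(2L)`,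
  -- and `exp(-2)` for the `1/4`.
  have hterm1 : (1 - 1 / (4 * (k : ℝ))) ^ r * (n * Real.exp G) ≤ Real.exp (-(A * L)) / 4 := by
    have h1 : (1 - 1 / (4 * (k : ℝ))) ^ r ≤ Real.exp (-((A + 2) * L + 2)) := by
      have h2 : 0 ≤ 1 - 1 / (4 * (k : ℝ)) := by
        rw [sub_nonneg, div_le_one (by linarith)]; linarith
      calc (1 - 1 / (4 * (k : ℝ))) ^ r ≤ Real.exp (-(1 / (4 * (k : ℝ)))) ^ r :=
            pow_le_pow_left₀ h2 (Real.one_sub_le_exp_neg _) r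
        _ = Real.exp (-(r / (4 * (k : ℝ)))) := by rw [← Real.exp_nat_mul]; congr 1; ring
        _ ≤ _ := by
            refine Real.exp_le_exp.2 (neg_le_neg ?_)
            rw [le_div_iff₀ (by linarith)]
            linarith
    calc _ ≤ Real.exp (-((A + 2) * L + 2)) * (Real.exp L * Real.exp L) := by
          rw [← hnL]
          refine mul_le_mul h1 ?_ (by positivity) (Real.exp_pos _).le
          refine mul_le_mul_of_nonneg_left ?_ hn'.le
          rw [hnL]; exact Real.exp_le_exp.2 hGL
      _ = Real.exp (-(A * L)) * Real.exp (-2) := by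
          rw [← Real.exp_add, ← Real.exp_add, ← Real.exp_add]; congr 1; ring
      _ ≤ _ := by
          rw [div_eq_mul_one_div]
          exact mul_le_mul_of_nonneg_left e2 (Real.exp_pos _).le
  -- Of the decay `exp(-(A+3)L)`, two powers of `n` pay for the factor `n²`; the third is at most
  -- `exp(-3) ≤ 1/16`, which absorbs the constant `4`. This is where `log n ≥ 3` enters.
  have hterm2 : 2 * ((n : ℝ) ^ 2 * (G ^ N / N.factorial * 2)) ≤ Real.exp (-(A * L)) / 4 := by
    have h1 : G ^ N / N.factorial ≤ Real.exp (-((A + 3) * L)) := by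
      refine (pow_div_factorial_le_pow hG0 hN).trans ?_
      refine (pow_le_pow_left₀ (by positivity) hGN N).trans ?_
      rw [Real.rpow_def_of_pos hL0, ← Real.exp_nat_mul]
      refine Real.exp_le_exp.2 ?_
      linarith
    have h3 : Real.exp (-L) ≤ 1 / 16 := by
      have h4 : Real.exp (-L) ≤ Real.exp (-3) := Real.exp_le_exp.2 (by linarith)
      refine h4.trans ?_
      rw [Real.exp_neg, ← one_div]
      refine one_div_le_one_div_of_le (by norm_num) ?_
      have h5 : Real.exp 3 = Real.exp 1 ^ 3 := by rw [← Real.exp_nat_mul]; norm_num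
      have h6 : (2.7 : ℝ) ≤ Real.exp 1 := by linarith [Real.exp_one_gt_d9]
      have := pow_le_pow_left₀ (by norm_num) h6 3
      rw [h5]
      linarith
    calc _ = 4 * ((n : ℝ) ^ 2 * (G ^ N / N.factorial)) := by ring
      _ ≤ 4 * ((n : ℝ) ^ 2 * Real.exp (-((A + 3) * L))) := by gcongr
      _ = 4 * (Real.exp (-(A * L)) * Real.exp (-L)) := by
          rw [hnL, ← Real.exp_nat_mul, ← Real.exp_add, ← Real.exp_add]
          congr 2; push_cast; ring
      _ ≤ 4 * (Real.exp (-(A * L)) * (1 / 16)) := by gcongr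
      _ = _ := by ring
  linarith

/-! ## Subpolynomial growth -/

theorem tendsto_log_natCast : Tendsto (fun n : ℕ => Real.log n) atTop atTop :=
  Real.tendsto_log_atTop.comp tendsto_natCast_atTop_atTop

theorem tendsto_log_log_natCast : Tendsto (fun n : ℕ => Real.log (Real.log n)) atTop atTop :=
  Real.tendsto_log_atTop.comp tendsto_log_natCast

theorem const_isLittleO_of_tendsto {u : ℕ → ℝ} (hu : Tendsto u atTop atTop) (c : ℝ) :
    (fun _ : ℕ => c) =o[atTop] u :=
  isLittleO_const_left.2 (Or.inr (tendsto_norm_atTop_atTop.comp hu))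

theorem rpow_isLittleO_of_lt_one {u : ℕ → ℝ} (hu : Tendsto u atTop atTop) {p : ℝ} (hp : p < 1) :
    (fun n => u n ^ p) =o[atTop] u := by
  refine isLittleO_of_tendsto' ?_ ?_
  · filter_upwards [hu.eventually_gt_atTop 0] with n hn h
    exact absurd h hn.ne'
  · have h := (tendsto_rpow_neg_atTop (sub_pos.2 hp)).comp hu
    refine h.congr' ?_
    filter_upwards [hu.eventually_gt_atTop 0] with n hn
    rw [Function.comp_apply, eq_div_iff hn.ne', ← Real.rpow_add_one hn.ne']
    congr 1; ring

theorem eventually_eq_rpow_of_log_isLittleO {f : ℕ → ℝ} (hpos : ∀ᶠ n in atTop, 0 < f n)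
    (hlog : (fun n => Real.log (f n)) =o[atTop] fun n : ℕ => Real.log n) :
    ∃ e : ℕ → ℝ, e =o[atTop] (fun _ => (1 : ℝ)) ∧ ∀ᶠ n : ℕ in atTop, f n = (n : ℝ) ^ e n := by
  refine ⟨fun n => Real.log (f n) / Real.log n, ?_, ?_⟩
  · rw [isLittleO_one_iff]
    exact hlog.tendsto_div_nhds_zero
  · filter_upwards [hpos, tendsto_log_natCast.eventually_gt_atTop 0,
      eventually_gt_atTop 0] with n hf hL hn
    rw [Real.rpow_def_of_pos (by exact_mod_cast hn), mul_div_cancel₀ _ hL.ne', Real.exp_log hf]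

theorem runsInNearLinearTime_of_log_isLittleO {d r : ℕ → ℕ}
    (hd : (fun n : ℕ => (d n : ℝ)) =o[atTop] fun n : ℕ => Real.log n)
    (hr1 : ∀ᶠ n in atTop, 1 ≤ r n)
    (hr : (fun n => Real.log (r n)) =o[atTop] fun n : ℕ => Real.log n) :
    RunsInNearLinearTime d r := by
  have hlog : (fun n => Real.log (300 * ((r n : ℝ) + d n + 1) ^ 3)) =o[atTop]
      fun n : ℕ => Real.log n := by
    have h1 : (fun n : ℕ => Real.log 300 + 3 * (Real.log 2 + Real.log (r n) + d n)) =o[atTop]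
        fun n : ℕ => Real.log n :=
      (const_isLittleO_of_tendsto tendsto_log_natCast _).add
        ((((const_isLittleO_of_tendsto tendsto_log_natCast _).add hr).add hd).const_mul_left 3)
    refine IsBigO.trans_isLittleO (IsBigO.of_bound 1 ?_) h1
    filter_upwards [hr1] with n hn
    have hn' : (1 : ℝ) ≤ r n := by exact_mod_cast hn
    have hd0 : (0 : ℝ) ≤ d n := Nat.cast_nonneg _
    have h2 : 1 ≤ 300 * ((r n : ℝ) + d n + 1) ^ 3 := by
      have : (1 : ℝ) ≤ ((r n : ℝ) + d n + 1) ^ 3 := one_le_pow₀ (by linarith)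
      linarith
    rw [one_mul, Real.norm_of_nonneg (Real.log_nonneg h2)]
    refine le_trans ?_ (le_abs_self _)
    rw [Real.log_mul (by norm_num) (by positivity), Real.log_pow]
    -- The crude bound `r + d + 1 ≤ 2 r exp d` suffices, since `d` itself is `o(log n)`.
    have h3 : Real.log ((r n : ℝ) + d n + 1) ≤ Real.log 2 + Real.log (r n) + d n := by
      rw [← Real.log_mul (by norm_num) (by positivity),
        Real.log_le_iff_le_exp (by positivity), Real.exp_add, Real.exp_log (by positivity)]
      have := Real.add_one_le_exp (d n : ℝ)
      nlinarith
    push_cast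
    linarith
  obtain ⟨e, he, hev⟩ := eventually_eq_rpow_of_log_isLittleO
    (Eventually.of_forall fun n => by positivity) hlog
  refine ⟨e, he, ?_⟩
  filter_upwards [hev, eventually_ge_atTop 1] with n hne hn m β Q K V x hx
  have := costLE_wildcat Q K V β hn (r n) x hx
  rw [← hne]
  calc (x.cost : ℝ) ≤ ((300 * (m + n) * (r n + d n + 1) ^ 3 : ℕ) : ℝ) := by exact_mod_cast this
    _ = _ := by push_cast; ring

/-! ## The choice of the rank -/

section Rank

variable {α : ℝ} {g a : ℕ → ℝ} {d : ℕ → ℕ}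

/-- The (real) degree bound for the monomials. -/
def degreeBound (α a L : ℝ) : ℝ :=
  (traceExponent a + 3) * L / ((1 - α) / 4 * Real.log L) + L ^ ((1 + α) / 2)

theorem traceExponent_isLittleO
    (ha : a =o[atTop] fun n : ℕ => Real.log (Real.log n)) :
    (fun n => traceExponent (a n)) =o[atTop] fun n : ℕ => Real.log (Real.log n) := by
  have h : (fun n => 2 * |a n| + (2 + 3 / (2 * lambertFloor))) =o[atTop]
      fun n : ℕ => Real.log (Real.log n) :=
    (ha.abs_left.const_mul_left 2).add (const_isLittleO_of_tendsto tendsto_log_log_natCast _)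
  refine h.congr_left fun n => ?_
  rw [traceExponent]; ring

/-- The first summand is `log n` times a multiple of `(traceExponent a + 3) / log log n`, which
tends to zero exactly because `a = o(log log n)`; the second has exponent `(1+α)/2 < 1`. -/
theorem degreeBound_isLittleO (hα₁ : α < 1)
    (ha : a =o[atTop] fun n : ℕ => Real.log (Real.log n)) :
    (fun n : ℕ => degreeBound α (a n) (Real.log n)) =o[atTop] fun n : ℕ => Real.log n := by
  have h1 : Tendsto (fun n : ℕ => (traceExponent (a n) + 3) / Real.log (Real.log n)) atTop
      (nhds 0) :=
    ((traceExponent_isLittleO ha).add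
      (const_isLittleO_of_tendsto tendsto_log_log_natCast 3)).tendsto_div_nhds_zero
  refine IsLittleO.add ?_ ?_
  · have h2 : (fun n : ℕ => (traceExponent (a n) + 3) / Real.log (Real.log n) *
        (Real.log n * (4 / (1 - α)))) =o[atTop] fun n : ℕ => Real.log n := by
      have h3 : (fun n : ℕ => (traceExponent (a n) + 3) / Real.log (Real.log n)) =o[atTop]
          fun _ => (1 : ℝ) := (isLittleO_one_iff ℝ).2 h1
      have h4 : (fun n : ℕ => Real.log n * (4 / (1 - α))) =O[atTop] fun n : ℕ => Real.log n :=
        ((isBigO_refl _ _).const_mul_left (4 / (1 - α))).congr_left fun n => mul_comm _ _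
      simpa using h3.mul_isBigO h4
    refine h2.congr_left fun n => ?_
    have : 1 - α ≠ 0 := by linarith
    by_cases h : Real.log (Real.log n) = 0
    · simp [h]
    · field_simp
  · exact rpow_isLittleO_of_lt_one tendsto_log_natCast (by linarith)

/-- The degree bound for the monomials. -/
def degreeFor (α : ℝ) (a : ℕ → ℝ) (n : ℕ) : ℕ := ⌈degreeBound α (a n) (Real.log n)⌉₊

theorem degreeBound_pos {a L : ℝ} (hα₁ : α < 1) (hL : 1 < L) : 0 < degreeBound α a L := by
  have := traceExponent_nonneg a
  have h1 := Real.log_pos hL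
  have h2 : 0 < (1 - α) / 4 := by linarith
  have : 0 < L ^ ((1 + α) / 2) := Real.rpow_pos_of_pos (by linarith) _
  unfold degreeBound
  positivity

theorem degreeFor_isLittleO (hα₁ : α < 1)
    (ha : a =o[atTop] fun n : ℕ => Real.log (Real.log n)) :
    (fun n : ℕ => (degreeFor α a n : ℝ)) =o[atTop] fun n : ℕ => Real.log n := by
  refine IsBigO.trans_isLittleO (IsBigO.of_bound 1 ?_)
    ((degreeBound_isLittleO hα₁ ha).add (const_isLittleO_of_tendsto tendsto_log_natCast 1))
  filter_upwards [tendsto_log_natCast.eventually_gt_atTop 1] with n hL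
  rw [one_mul, Real.norm_of_nonneg (Nat.cast_nonneg _)]
  exact (Nat.ceil_lt_add_one (degreeBound_pos hα₁ hL).le).le.trans (le_abs_self _)

/-- Take `κ = (1-α)/4`. Eventually `e |g n| ≤ L^{α+κ}`, and `α + κ = (1+α)/2 - κ`, so the second
summand of `degreeBound` makes the base of the remainder at most `L^{-κ}`. The first summand makes
`N` large enough that `L^{-κN} ≤ n^{-(traceExponent a + 3)}`. -/
theorem eventually_rankAttains (hα₁ : α < 1)
    (hg : g =O[atTop] fun n : ℕ => Real.log n ^ α) (d : ℕ → ℕ) :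
    ∀ᶠ n : ℕ in atTop, RankAttains n (d n) |g n| ((n : ℝ) ^ (-a n))
      (rankFor n (d n) (degreeFor α a n) (a n)) := by
  obtain ⟨C, hC, hgC⟩ := hg.exists_pos
  have hκ : 0 < (1 - α) / 4 := by linarith
  have hpow := (tendsto_rpow_atTop hκ).comp tendsto_log_natCast
  filter_upwards [hgC.bound, tendsto_log_natCast.eventually_ge_atTop 3,
    hpow.eventually_ge_atTop (C * Real.exp 1)] with n hgn hL hCL
  simp only [Function.comp_apply] at hCL
  set L := Real.log n with hLdef
  have hL0 : 0 < L := by linarith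
  have hL1 : 1 < L := by linarith
  have hll := Real.log_pos hL1
  have hA := traceExponent_nonneg (a n)
  rw [Real.norm_eq_abs, Real.norm_of_nonneg (Real.rpow_nonneg hL0.le _)] at hgn
  set N := degreeFor α a n with hN
  have hNb : degreeBound α (a n) L ≤ N := Nat.le_ceil _
  have hN1 : 1 ≤ N := Nat.one_le_iff_ne_zero.2 (Nat.ceil_pos.2 (degreeBound_pos hα₁ hL1)).ne'
  have hNpos : (0 : ℝ) < N := by exact_mod_cast hN1
  have hb1 : (traceExponent (a n) + 3) * L / ((1 - α) / 4 * Real.log L) ≤ N := by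
    refine le_trans ?_ hNb
    have := Real.rpow_pos_of_pos hL0 ((1 + α) / 2)
    rw [degreeBound]; linarith
  have hb2 : L ^ ((1 + α) / 2) ≤ N := by
    refine le_trans ?_ hNb
    have : 0 ≤ (traceExponent (a n) + 3) * L / ((1 - α) / 4 * Real.log L) := by positivity
    rw [degreeBound]; linarith
  have hge : |g n| * Real.exp 1 ≤ L ^ ((1 - α) / 4 + α) := by
    rw [Real.rpow_add hL0]
    calc |g n| * Real.exp 1 ≤ C * L ^ α * Real.exp 1 := by gcongr
      _ = C * Real.exp 1 * L ^ α := by ring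
      _ ≤ _ := by gcongr
  refine rankAttains_rankFor (κ := (1 - α) / 4) (d n) hN1 hL (abs_nonneg _) ?_ hκ.le ?_ ?_
  · have h1 : L ^ ((1 - α) / 4 + α) ≤ L ^ (1 : ℝ) :=
      Real.rpow_le_rpow_of_exponent_le hL1.le (by linarith)
    rw [Real.rpow_one] at h1
    have h2 : |g n| ≤ |g n| * Real.exp 1 :=
      le_mul_of_one_le_right (abs_nonneg _) (Real.one_le_exp zero_le_one)
    linarith
  · rw [div_le_iff₀ hNpos]
    refine hge.trans ?_
    calc L ^ ((1 - α) / 4 + α) = L ^ (-((1 - α) / 4)) * L ^ ((1 + α) / 2) := by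
          rw [← Real.rpow_add hL0]; congr 1; ring
      _ ≤ _ := by gcongr
  · rw [div_le_iff₀ (by positivity)] at hb1
    linarith

theorem one_le_rankFor {n : ℕ} (hL : 0 ≤ Real.log n) (d : ℕ) {N : ℕ} (hN : 1 ≤ N) (a : ℝ) :
    1 ≤ rankFor n d N a := by
  have := traceExponent_nonneg a
  refine Nat.one_le_iff_ne_zero.2 (Nat.ceil_pos.2 ?_).ne'
  have hk : 0 < ((N * 2 ^ (d + N) : ℕ) : ℝ) := by positivity
  have hX : 0 ≤ (traceExponent a + 2) * Real.log n := mul_nonneg (by linarith) hL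
  exact mul_pos (by linarith) (by linarith)

/-- Eventually the rank is at most `5 exp(2N + d) L³`, whose logarithm is `o(log n)` because `N`,
`d` and `log L` are. -/
theorem log_rankFor_isLittleO (hα₁ : α < 1)
    (hd : (fun n : ℕ => (d n : ℝ)) =o[atTop] fun n : ℕ => Real.log n)
    (ha : a =o[atTop] fun n : ℕ => Real.log (Real.log n)) :
    (∀ᶠ n : ℕ in atTop, 1 ≤ rankFor n (d n) (degreeFor α a n) (a n)) ∧
    (fun n : ℕ => Real.log (rankFor n (d n) (degreeFor α a n) (a n))) =o[atTop]
      fun n : ℕ => Real.log n := by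
  have hN1 : ∀ᶠ n : ℕ in atTop, 1 ≤ degreeFor α a n := by
    filter_upwards [tendsto_log_natCast.eventually_gt_atTop 1] with n hL
    exact Nat.one_le_iff_ne_zero.2 (Nat.ceil_pos.2 (degreeBound_pos hα₁ hL)).ne'
  have hone : ∀ᶠ n : ℕ in atTop, 1 ≤ rankFor n (d n) (degreeFor α a n) (a n) := by
    filter_upwards [tendsto_log_natCast.eventually_ge_atTop 0, hN1] with n hL hN
    exact one_le_rankFor hL _ hN _
  refine ⟨hone, ?_⟩
  have hll : (fun n : ℕ => Real.log (Real.log n)) =o[atTop] fun n : ℕ => Real.log n :=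
    Real.isLittleO_log_id_atTop.comp_tendsto tendsto_log_natCast
  have hdeg := degreeFor_isLittleO hα₁ ha
  have hsum : (fun n : ℕ => Real.log 5 + (2 * (degreeFor α a n : ℝ) + d n) +
      3 * Real.log (Real.log n)) =o[atTop] fun n : ℕ => Real.log n :=
    ((const_isLittleO_of_tendsto tendsto_log_natCast _).add
      ((hdeg.const_mul_left 2).add hd)).add (hll.const_mul_left 3)
  refine IsBigO.trans_isLittleO (IsBigO.of_bound 1 ?_) hsum
  have hAL : ∀ᶠ n : ℕ in atTop, traceExponent (a n) + 2 ≤ Real.log n := by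
    have h := (((traceExponent_isLittleO ha).trans hll).add
      (const_isLittleO_of_tendsto tendsto_log_natCast 2)).bound one_pos
    filter_upwards [h, tendsto_log_natCast.eventually_ge_atTop 0] with n hn hL
    rw [one_mul, Real.norm_of_nonneg hL] at hn
    exact (le_abs_self _).trans hn
  filter_upwards [hone, hN1, hAL, tendsto_log_natCast.eventually_ge_atTop 2] with n hr hN hA hL
  have hr' : (1 : ℝ) ≤ rankFor n (d n) (degreeFor α a n) (a n) := by exact_mod_cast hr
  rw [one_mul, Real.norm_of_nonneg (Real.log_nonneg hr')]
  refine le_trans ?_ (le_abs_self _)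
  set L := Real.log n
  set N := degreeFor α a n
  have hN' : (1 : ℝ) ≤ N := by exact_mod_cast hN
  have hA0 := traceExponent_nonneg (a n)
  set X := (traceExponent (a n) + 2) * L + 2 with hX
  have hX1 : 1 ≤ X := by
    have : 0 ≤ (traceExponent (a n) + 2) * L := by positivity
    linarith
  have hXL : X ≤ L ^ 3 := by
    have h1 : (traceExponent (a n) + 2) * L ≤ L * L := by gcongr
    have h2 : 2 * 2 ≤ L * L := by gcongr
    have h3 : 2 * (L * L) ≤ L * (L * L) := by gcongr
    rw [hX, pow_succ', sq]
    linarith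
  have hk : ((N * 2 ^ (d n + N) : ℕ) : ℝ) ≤ Real.exp (2 * N + d n) := by
    have h1 : (N : ℝ) ≤ Real.exp N := by linarith [Real.add_one_le_exp (N : ℝ)]
    have h2 : (2 : ℝ) ≤ Real.exp 1 := by linarith [Real.add_one_le_exp (1 : ℝ)]
    have h3 : (2 : ℝ) ^ (d n + N) ≤ Real.exp (d n + N) := by
      refine (pow_le_pow_left₀ two_pos.le h2 _).trans (le_of_eq ?_)
      rw [← Real.exp_nat_mul, mul_one]; push_cast; rfl
    push_cast
    calc (N : ℝ) * 2 ^ (d n + N) ≤ Real.exp N * Real.exp (d n + N) := by gcongr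
      _ = _ := by rw [← Real.exp_add]; congr 1; ring
  have hk1 : (1 : ℝ) ≤ ((N * 2 ^ (d n + N) : ℕ) : ℝ) := by
    exact_mod_cast Nat.one_le_iff_ne_zero.2 (by positivity)
  have hrle : (rankFor n (d n) N (a n) : ℝ) ≤ 5 * Real.exp (2 * N + d n) * L ^ 3 := by
    have h1 : (rankFor n (d n) N (a n) : ℝ) ≤ 4 * ((N * 2 ^ (d n + N) : ℕ) : ℝ) * X + 1 :=
      (Nat.ceil_lt_add_one (by positivity)).le
    have h2 : 1 ≤ ((N * 2 ^ (d n + N) : ℕ) : ℝ) * X := one_le_mul_of_one_le_of_one_le hk1 hX1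
    have h3 : ((N * 2 ^ (d n + N) : ℕ) : ℝ) * X ≤ Real.exp (2 * N + d n) * L ^ 3 :=
      mul_le_mul hk hXL (by linarith) (Real.exp_pos _).le
    linarith
  refine (Real.log_le_log (by linarith) hrle).trans (le_of_eq ?_)
  have hL0 : L ≠ 0 := by linarith
  rw [Real.log_mul (by positivity) (by positivity), Real.log_mul (by norm_num) (by positivity),
    Real.log_exp, Real.log_pow]
  push_cast
  ring

/-- Ranks of subpolynomial growth attain the error `3 ‖V‖ n ^ (-a n)`. -/
theorem exists_rank (hα₁ : α < 1) (hg : g =O[atTop] fun n : ℕ => Real.log n ^ α)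
    (hd : (fun n : ℕ => (d n : ℝ)) =o[atTop] fun n : ℕ => Real.log n)
    (ha : a =o[atTop] fun n : ℕ => Real.log (Real.log n)) :
    ∃ r : ℕ → ℕ, IsSubpolynomial (fun n => (r n : ℝ)) ∧ RunsInNearLinearTime d r ∧
      ∀ n : ℕ, 1 ≤ n → RankAttains n (d n) |g n| ((n : ℝ) ^ (-a n)) (r n) := by
  classical
  have hex : ∀ n : ℕ, ∃ r, 1 ≤ n → RankAttains n (d n) |g n| ((n : ℝ) ^ (-a n)) r := by
    intro n
    by_cases hn : 1 ≤ n
    · obtain ⟨r, hr⟩ := exists_rankAttains hn (d n) |g n|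
        (Real.rpow_pos_of_pos (by exact_mod_cast hn : (0 : ℝ) < n) (-a n))
      exact ⟨r, fun _ => hr⟩
    · exact ⟨0, fun h => absurd h hn⟩
  choose r₁ hr₁ using hex
  set r₀ : ℕ → ℕ := fun n => rankFor n (d n) (degreeFor α a n) (a n) with hr₀
  obtain ⟨hone, hlog⟩ := log_rankFor_isLittleO hα₁ hd ha
  -- The explicit rank is used wherever it works, hence for all large `n`; at the remaining `n` any
  -- sufficient rank does, without effect on the growth rate.
  set r : ℕ → ℕ := fun n =>
    if RankAttains n (d n) |g n| ((n : ℝ) ^ (-a n)) (r₀ n) then r₀ n else r₁ n with hr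
  have heq : ∀ᶠ n in atTop, r₀ n = r n := by
    filter_upwards [eventually_rankAttains (a := a) hα₁ hg d] with n hn
    rw [hr]; exact (if_pos hn).symm
  have hone' : ∀ᶠ n in atTop, 1 ≤ r n := by
    filter_upwards [heq, hone] with n h1 h2
    rwa [← h1]
  have hlog' : (fun n => Real.log (r n)) =o[atTop] fun n : ℕ => Real.log n := by
    refine hlog.congr' ?_ EventuallyEq.rfl
    filter_upwards [heq] with n h1
    rw [← h1]
  refine ⟨r, ?_, runsInNearLinearTime_of_log_isLittleO hd hone' hlog', fun n hn => ?_⟩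
  · refine eventually_eq_rpow_of_log_isLittleO ?_ hlog'
    filter_upwards [hone'] with n hn
    exact_mod_cast hn
  · rw [hr]
    dsimp only
    split_ifs with h
    · exact h
    · exact hr₁ n hn

end Rank

end WildCat

end

theorem mainTheorem4 (α : ℝ) (hα₀ : 0 < α) (hα₁ : α < 1) (g : ℕ → ℝ) (d : ℕ → ℕ)
    (hg : g =O[atTop] fun n : ℕ => Real.log n ^ α)
    (hd : (fun n : ℕ => (d n : ℝ)) =o[atTop] fun n : ℕ => Real.log n) :
    (∀ a : ℕ → ℝ, a =o[atTop] (fun n : ℕ => Real.log (Real.log n)) →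
      ∃ r : ℕ → ℕ, WildCat.IsSubpolynomial (fun n => (r n : ℝ)) ∧
        WildCat.RunsInNearLinearTime d r ∧
        ∀ n : ℕ, 1 ≤ n → ∀ (m : ℕ) (β : ℝ) (Q : Matrix (Fin m) (Fin (d n)) ℝ)
          (K V : Matrix (Fin n) (Fin (d n)) ℝ), 0 < β →
          β * WildCat.rowNorm Q * WildCat.rowNorm (WildCat.recentred K) ≤ g n →
          WildCat.expectedError Q K V β (r n) ≤
            ENNReal.ofReal (3 * WildCat.maxNorm V * (n : ℝ) ^ (-a n))) ∧
    (∃ r : ℕ → ℕ, WildCat.IsSubpolynomial (fun n => (r n : ℝ)) ∧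
      WildCat.RunsInNearLinearTime d r ∧
      ∀ t : ℝ, ∀ᶠ n : ℕ in atTop, ∀ (m : ℕ) (β : ℝ) (Q : Matrix (Fin m) (Fin (d n)) ℝ)
        (K V : Matrix (Fin n) (Fin (d n)) ℝ), 0 < β →
        β * WildCat.rowNorm Q * WildCat.rowNorm (WildCat.recentred K) ≤ g n →
        WildCat.expectedError Q K V β (r n) ≤
          ENNReal.ofReal (WildCat.maxNorm V * (n : ℝ) ^ (-t))) := by
  constructor
  · intro a ha
    obtain ⟨r, h1, h2, h3⟩ := WildCat.exists_rank hα₁ hg hd ha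
    exact ⟨r, h1, h2, fun n hn m β Q K V hβ hG =>
      h3 n hn m β Q K V hβ (hG.trans (le_abs_self _))⟩
  -- The choice `a = √(log log n)` tends to infinity, so it eventually exceeds every `t + 1`, and it
  -- is still `o(log log n)`.
  · have hsqrt : Tendsto (fun n : ℕ => Real.sqrt (Real.log (Real.log n))) atTop atTop :=
      Real.tendsto_sqrt_atTop.comp WildCat.tendsto_log_log_natCast
    have ha : (fun n : ℕ => Real.sqrt (Real.log (Real.log n))) =o[atTop]
        fun n : ℕ => Real.log (Real.log n) := by
      simp only [Real.sqrt_eq_rpow]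
      exact WildCat.rpow_isLittleO_of_lt_one WildCat.tendsto_log_log_natCast (by norm_num)
    obtain ⟨r, h1, h2, h3⟩ := WildCat.exists_rank hα₁ hg hd ha
    refine ⟨r, h1, h2, fun t => ?_⟩
    filter_upwards [eventually_ge_atTop 3, hsqrt.eventually_ge_atTop (t + 1)]
      with n hn hat m β Q K V hβ hG
    refine (h3 n (by omega) m β Q K V hβ (hG.trans (le_abs_self _))).trans
      (ENNReal.ofReal_le_ofReal ?_)
    have hn3 : (3 : ℝ) ≤ n := by exact_mod_cast hn
    have hn0 : (0 : ℝ) < n := by linarith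
    -- The spare factor `1/n` absorbs the constant `3` as soon as `n ≥ 3`.
    have h4 : (n : ℝ) ^ (-Real.sqrt (Real.log (Real.log n))) ≤ (n : ℝ) ^ (-t) * (n : ℝ)⁻¹ := by
      rw [← Real.rpow_neg_one, ← Real.rpow_add hn0]
      exact Real.rpow_le_rpow_of_exponent_le (by linarith) (by linarith)
    have h5 : 3 * (n : ℝ)⁻¹ ≤ 1 := by
      rw [← div_eq_mul_inv, div_le_one hn0]; exact hn3
    have h6 : 3 * (n : ℝ) ^ (-Real.sqrt (Real.log (Real.log n))) ≤ (n : ℝ) ^ (-t) := by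
      have h7 : 0 < (n : ℝ) ^ (-t) := Real.rpow_pos_of_pos hn0 _
      nlinarith
    have := mul_le_mul_of_nonneg_left h6 (WildCat.maxNorm_nonneg V)
    linarith
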